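/- A loopless mixed graph has a finite node set $V$ and undirected ($i-j$), bidirected ($i\leftrightarrow j$) and directed ($i\to j$) edges between distinct nodes; paths have no repeated nodes. An inner node of a path is a collider on it if both path edges at that node have an arrowhead there. For $C\subseteq V$, a path is $m$-connecting given $C$ if each collider on it lies in $C$ or is an ancestor of a node of $C$ (along directed paths) and all its other nodes, including its endpoints, are outside $C$. The independence model $\mathcal J(\mathcal G)$ is the set of triples $\langle A,B\mid C\rangle$ of subsets of $V$ with $A\cap B=\emptyset$ such that no path between a node of $A$ and a node of $B$ is $m$-connecting given $C$; $\mathcal G,\mathcal H$ on the same node set are Markov equivalent if $\mathcal J(\mathcal G)=\mathcal J(\mathcal H)$. $\mathcal G$ is ancestral if it has no directed cycle, if $i\leftrightarrow j$ implies that there is no directed path from $i$ to $j$ or from $j$ to $i$, and if $i-j$ implies that no edge has an arrowhead at $i$ or $j$. The endpoints of undirected edges are called selection-adjacent. An inducing path between $i$ and $j$ is a path all of whose inner nodes are colliders on it and ancestors of $i$ or $j$. The maximal extension $\overline{\mathcal G}$ of an ancestral graph $\mathcal G$ is obtained by adding $i\leftrightarrow j$ for all distinct nonadjacent $i,j$ that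 are joined by an inducing path in $\mathcal G$. Let $\mathcal I$ be a finite multiset of subsets of $V$ (intervention targets). It doubly-intervenes on $i\in V$ if $i$ lies in two distinct elements of the multiset (two copies of one set count as distinct). The graph $\mathcal G^{\mathcal I}$ is obtained from $\mathcal G$ by adding, for each nonempty element $I$ of $\mathcal I$ (with multiplicity), a new node $\omega_I$ and the edges $\omega_I\to i$ for $i\in I$. $\mathcal G$ and $\mathcal H$ are $\mathcal I$-Markov equivalent if $\mathcal J(\mathcal G^{\mathcal I})=\mathcal J(\mathcal H^{\mathcal I})$. A path $\langle v_0,\dots,v_m,b,c\rangle$ is discriminating for $b$ if $v_0$ and $c$ are nonadjacent and each of $v_1,\dots,v_m$ is a collider on the path and a parent of $c$. A triple is a path $\langle i,j,k\rangle$ on three nodes. It has order $0$ if $i,k$ are nonadjacent. It has order $t+1$ if it has no order $s\le t$ and there is a discriminating path $\langle v_0,\dots,v_m,b,c\rangle$ such that $\langle i,j,k\rangle$ or $\langle k,j,i\rangle$ is $\langle v_m,b,c\rangle$ and each of $\langle v_0,v_1,v_2\rangle,\dots,\langle v_{m-1},v_m,b\rangle$ has some order $s\le t$. A collider with order is a triple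 $\langle i,j,k\rangle$ that has some order and whose two edges have arrowheads at $j$. The $\mathcal I$-colliders with order of $\mathcal G^{\mathcal I}$ are the colliders with order in $\mathcal G^{\mathcal I}$ that are not colliders with order in $\mathcal G$. Theorem. Let $\mathcal G$ and $\mathcal H$ be ancestral graphs on the same finite node set $V$, and let $\mathcal I$ be a finite multiset of subsets of $V$ that doubly-intervenes on no selection-adjacent node of $\mathcal G$ and on no selection-adjacent node of $\mathcal H$. Then the following are equivalent: 1. $\mathcal G$ and $\mathcal H$ are $\mathcal I$-Markov equivalent; 2. $\overline{\mathcal G}$ and $\overline{\mathcal H}$ are $\mathcal I$-Markov equivalent; 3. $\overline{\mathcal G}$ and $\overline{\mathcal H}$ are Markov equivalent, and $\overline{\mathcal G}^{\mathcal I}$ and $\overline{\mathcal H}^{\mathcal I}$ have the same $\mathcal I$-colliders with order. -/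

import Mathlib

/-- A loopless mixed graph on the node set `V`: undirected edges `i - j`, bidirected edges `i ↔ j`
and directed edges `i → j`. Edges of several types between the same two nodes are allowed. -/
structure LMG (V : Type*) where
  und : V → V → Prop
  bi : V → V → Prop
  dir : V → V → Prop
  und_symm : ∀ {i j}, und i j → und j i
  bi_symm : ∀ {i j}, bi i j → bi j i
  und_irrefl : ∀ i, ¬ und i i
  bi_irrefl : ∀ i, ¬ bi i i
  dir_irrefl : ∀ i, ¬ dir i i

/-- The four ways in which an edge can be traversed from a node `u` to a node `v`:
`u - v`, `u ↔ v`, `u → v`, `u ← v`. -/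
inductive EdgeKind where
  | line
  | arc
  | fwd
  | bwd

namespace EdgeKind

/-- The edge has an arrowhead at the node where the traversal starts. -/
def ArrowAtStart : EdgeKind → Prop
  | arc => True
  | bwd => True
  | line => False
  | fwd => False

/-- The edge has an arrowhead at the node where the traversal ends. -/
def ArrowAtEnd : EdgeKind → Prop
  | arc => True
  | fwd => True
  | line => False
  | bwd => False

end EdgeKind

namespace LMG

variable {V : Type*}

/-- The graph `G` has an edge of the given kind from `u` to `v`. -/
def HasEdge (G : LMG V) : EdgeKind → V → V → Prop
  | .line, u, v => G.und u v
  | .arc, u, v => G.bi u v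
  | .fwd, u, v => G.dir u v
  | .bwd, u, v => G.dir v u

/-- Two nodes are adjacent if they are the endpoints of some edge. -/
def Adj (G : LMG V) (u v : V) : Prop :=
  ∃ κ, G.HasEdge κ u v

/-- `i` is an ancestor of `j`: there is a directed path from `i` to `j` with at least one edge. -/
def IsAncestor (G : LMG V) (i j : V) : Prop :=
  Relation.TransGen G.dir i j

/-- The ancestors of the members of a set of nodes. -/
def ancestors (G : LMG V) (C : Set V) : Set V :=
  {i | ∃ j ∈ C, G.IsAncestor i j}

/-- `⟨v 0, e 0, v 1, e 1, …, e (n - 1), v n⟩` is a path (with `n` edges and without repeated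
nodes) in `G`. Values of `v` beyond `n` and of `e` beyond `n - 1` play no role. -/
def IsPath (G : LMG V) (n : ℕ) (v : ℕ → V) (e : ℕ → EdgeKind) : Prop :=
  (∀ k < n, G.HasEdge (e k) (v k) (v (k + 1))) ∧
    ∀ k ≤ n, ∀ l ≤ n, v k = v l → k = l

/-- On a path with edges `e`, the two edges `e k` and `e (k + 1)` at the inner node number `k + 1`
both have an arrowhead at that node. -/
def ColliderAt (e : ℕ → EdgeKind) (k : ℕ) : Prop :=
  (e k).ArrowAtEnd ∧ (e (k + 1)).ArrowAtStart

/-- The path is m-connecting given `C`: every collider on it is in `C` or an ancestor of a member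
of `C`, and all its other nodes, in particular its two endpoints, are outside `C`. -/
def MConnecting (G : LMG V) (C : Set V) (n : ℕ) (v : ℕ → V) (e : ℕ → EdgeKind) : Prop :=
  G.IsPath n v e ∧
    (∀ k, k + 1 < n → ColliderAt e k → v (k + 1) ∈ C ∪ G.ancestors C) ∧
    (∀ k, k + 1 < n → ¬ ColliderAt e k → v (k + 1) ∉ C) ∧
    v 0 ∉ C ∧ v n ∉ C

/-- `C` m-separates `A` and `B`: no path between a node of `A` and a node of `B` is m-connecting
given `C`. -/
def MSeparates (G : LMG V) (A B C : Set V) : Prop :=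
  ∀ n v e, v 0 ∈ A → v n ∈ B → ¬ G.MConnecting C n v e

/-- The formal independence model `J(G)`: the triples `⟨A, B ∣ C⟩` with `A`, `B` disjoint and
m-separated given `C`. -/
def indepModel (G : LMG V) : Set (Set V × Set V × Set V) :=
  {t | Disjoint t.1 t.2.1 ∧ G.MSeparates t.1 t.2.1 t.2.2}

/-- Markov equivalence. -/
def MarkovEquiv (G H : LMG V) : Prop :=
  G.indepModel = H.indepModel

/-- Ancestral graphs. -/
structure IsAncestral (G : LMG V) : Prop where
  no_directed_cycle : ∀ i, ¬ G.IsAncestor i i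
  bi_no_directed_path : ∀ i j, G.bi i j → ¬ G.IsAncestor i j ∧ ¬ G.IsAncestor j i
  und_no_arrowhead : ∀ i j, G.und i j → ∀ k,
    ¬ G.dir k i ∧ ¬ G.bi k i ∧ ¬ G.dir k j ∧ ¬ G.bi k j

/-- Selection adjacent nodes: the endpoints of undirected edges. -/
def SelectionAdjacent (G : LMG V) (i : V) : Prop :=
  ∃ j, G.und i j

/-- An inducing path between `v 0` and `v n`: every inner node is a collider on the path and an
ancestor of at least one of the two endpoints. -/
def IsInducingPath (G : LMG V) (n : ℕ) (v : ℕ → V) (e : ℕ → EdgeKind) : Prop :=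
  G.IsPath n v e ∧
    ∀ k, k + 1 < n → ColliderAt e k ∧
      (G.IsAncestor (v (k + 1)) (v 0) ∨ G.IsAncestor (v (k + 1)) (v n))

/-- There is an inducing path between `i` and `j`, in one of the two directions. -/
def InducingConnected (G : LMG V) (i j : V) : Prop :=
  ∃ n v e, G.IsInducingPath n v e ∧ ((v 0 = i ∧ v n = j) ∨ (v 0 = j ∧ v n = i))

theorem Adj.symm {G : LMG V} {i j : V} (h : G.Adj i j) : G.Adj j i := by
  obtain ⟨κ, h⟩ := h
  cases κ with
  | line => exact ⟨.line, G.und_symm h⟩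
  | arc => exact ⟨.arc, G.bi_symm h⟩
  | fwd => exact ⟨.bwd, h⟩
  | bwd => exact ⟨.fwd, h⟩

/-- The maximal extension of an ancestral graph: a bidirected edge is added between any two
distinct nonadjacent nodes that are the endpoints of an inducing path. -/
def maximalExtension (G : LMG V) : LMG V where
  und := G.und
  dir := G.dir
  bi i j := G.bi i j ∨ (i ≠ j ∧ ¬ G.Adj i j ∧ G.InducingConnected i j)
  und_symm := G.und_symm
  bi_symm := by
    rintro i j (h | ⟨h1, h2, n, v, e, hp, h3⟩)
    · exact Or.inl (G.bi_symm h)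
    · exact Or.inr ⟨h1.symm, fun h => h2 h.symm, n, v, e, hp, h3.symm⟩
  und_irrefl := G.und_irrefl
  bi_irrefl := by
    rintro i (h | h)
    · exact G.bi_irrefl i h
    · exact h.1 rfl
  dir_irrefl := G.dir_irrefl

/-! ### Interventions

A finite multiset of intervention targets is a finite family `T : ι → Set V` of sets of nodes; its
elements, with multiplicity, are the indices. -/

variable {ι : Type*}

/-- The node `i` lies in two distinct elements of the multiset of targets. -/
def DoublyIntervenes (T : ι → Set V) (i : V) : Prop :=
  ∃ k l, k ≠ l ∧ i ∈ T k ∧ i ∈ T l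

/-- The interventional nodes `ω_I`, one for each nonempty element of the multiset of targets. -/
abbrev InterventionNode (T : ι → Set V) : Type _ :=
  {k : ι // (T k).Nonempty}

/-- The directed edges of the interventional graph: those of `G`, and `ω_I → i` for `i ∈ I`. -/
def interventionalDir (G : LMG V) (T : ι → Set V) :
    V ⊕ InterventionNode T → V ⊕ InterventionNode T → Prop
  | .inl i, .inl j => G.dir i j
  | .inr w, .inl j => j ∈ T w.1
  | _, .inr _ => False

/-- A relation on `V`, viewed as a relation on the larger node set. -/
def liftRel (T : ι → Set V) (r : V → V → Prop) :
    V ⊕ InterventionNode T → V ⊕ InterventionNode T → Prop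
  | .inl i, .inl j => r i j
  | _, _ => False

/-- The interventional graph of `G` for the targets `T`. -/
def interventional (G : LMG V) (T : ι → Set V) : LMG (V ⊕ InterventionNode T) where
  und := liftRel T G.und
  bi := liftRel T G.bi
  dir := G.interventionalDir T
  und_symm := by
    rintro (i | i) (j | j) h
    · exact G.und_symm h
    all_goals exact h.elim
  bi_symm := by
    rintro (i | i) (j | j) h
    · exact G.bi_symm h
    all_goals exact h.elim
  und_irrefl := by
    rintro (i | i) h
    · exact G.und_irrefl i h
    · exact h
  bi_irrefl := by
    rintro (i | i) h
    · exact G.bi_irrefl i h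
    · exact h
  dir_irrefl := by
    rintro (i | i) h
    · exact G.dir_irrefl i h
    · exact h

/-- Interventional Markov equivalence for the targets `T`. -/
def IMarkovEquiv (T : ι → Set V) (G H : LMG V) : Prop :=
  (G.interventional T).indepModel = (H.interventional T).indepModel

/-! ### Colliders with order -/

/-- `⟨i, j, k⟩` is a path on three nodes. -/
def IsTriple (G : LMG V) (i j k : V) : Prop :=
  i ≠ k ∧ G.Adj i j ∧ G.Adj j k

/-- `⟨i, j, k⟩` is a path on three nodes whose two edges have an arrowhead at `j`. -/
def IsCollider (G : LMG V) (i j k : V) : Prop :=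
  i ≠ k ∧ (G.dir i j ∨ G.bi i j) ∧ (G.dir k j ∨ G.bi k j)

/-- `⟨v 0, v 1, …, v m, v (m + 1), v (m + 2)⟩` is a discriminating path for `v (m + 1)`: the first
and the last node are nonadjacent, and each of `v 1, …, v m` is a collider on the path and a parent
of the last node. -/
def IsDiscriminatingPath (G : LMG V) (m : ℕ) (v : ℕ → V) (e : ℕ → EdgeKind) : Prop :=
  G.IsPath (m + 2) v e ∧ ¬ G.Adj (v 0) (v (m + 2)) ∧
    ∀ k < m, ColliderAt e k ∧ G.dir (v (k + 1)) (v (m + 2))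

/-- The triples of order at most `t`. -/
def TripleOfOrderLE (G : LMG V) : ℕ → V → V → V → Prop
  | 0, i, j, k => G.IsTriple i j k ∧ ¬ G.Adj i k
  | t + 1, i, j, k => G.TripleOfOrderLE t i j k ∨
      ∃ m v e, G.IsDiscriminatingPath m v e ∧
        (∀ l < m, G.TripleOfOrderLE t (v l) (v (l + 1)) (v (l + 2))) ∧
        ((i = v m ∧ j = v (m + 1) ∧ k = v (m + 2)) ∨
          (k = v m ∧ j = v (m + 1) ∧ i = v (m + 2)))

/-- The triples of order `t`: those of order at most `t` that are of no smaller order. -/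
def TripleOfOrder (G : LMG V) (t : ℕ) (i j k : V) : Prop :=
  G.TripleOfOrderLE t i j k ∧ ∀ s < t, ¬ G.TripleOfOrderLE s i j k

/-- The colliders with order: the colliders that are triples of order `t` for some `t`. -/
def collidersWithOrder (G : LMG V) : Set (V × V × V) :=
  {x | G.IsCollider x.1 x.2.1 x.2.2 ∧ ∃ t, G.TripleOfOrder t x.1 x.2.1 x.2.2}

/-- The interventional colliders with order: the colliders with order in the interventional graph
of `G` that are not colliders with order in `G`. -/
def ICollidersWithOrder (G : LMG V) (T : ι → Set V) :
    Set ((V ⊕ InterventionNode T) × (V ⊕ InterventionNode T) × (V ⊕ InterventionNode T)) :=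
  (G.interventional T).collidersWithOrder \
    (fun x : V × V × V => (Sum.inl x.1, Sum.inl x.2.1, Sum.inl x.2.2)) '' G.collidersWithOrder

end LMG

/-!
In an ancestral graph m-connection can be tested on walks. Among the walks connecting two nodes
given `C`, take a shortest one and, among these, one for which the directed walks from its colliders
to `C` have the least total length. It is a path, and in a maximal graph each triple on it that
matters for its connectedness has an order. Hence it survives in every maximal ancestral graph with
the same adjacencies and colliders with order, so that these data determine the independence model
of a maximal ancestral graph, and conversely.

The interventional graph of an ancestral graph need not be ancestral, since a selection-adjacent
node may be a target. Making the edges `ω → i` undirected at the selection-adjacent nodes `i`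
repairs this. As no selection-adjacent node is doubly intervened, the repaired graph has the same
colliders, hence the same independence model and colliders with order. Repairing commutes with
maximal extension and preserves maximality, so the theorem reduces to the result on maximal
ancestral graphs.
-/

namespace LMG

section Arrowheads

variable {V : Type*} {G : LMG V} {a b c i j k u v w : V}

/-! ### Arrowheads in ancestral graphs -/

/-- Some edge between `u` and `v` has an arrowhead at `v`. -/
def Into (G : LMG V) (u v : V) : Prop :=
  G.dir u v ∨ G.bi u v

/-- A mixed graph is simple if there is at most one edge between any two nodes. -/
def IsSimple (G : LMG V) : Prop :=
  ∀ ⦃u v κ κ'⦄, G.HasEdge κ u v → G.HasEdge κ' u v → κ = κ'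

theorem adj_iff : G.Adj u v ↔ G.und u v ∨ G.bi u v ∨ G.dir u v ∨ G.dir v u := by
  constructor
  · rintro ⟨κ, h⟩
    cases κ <;> simp_all [HasEdge]
  · rintro (h | h | h | h)
    exacts [⟨.line, h⟩, ⟨.arc, h⟩, ⟨.fwd, h⟩, ⟨.bwd, h⟩]

theorem adj_comm : G.Adj u v ↔ G.Adj v u :=
  ⟨Adj.symm, Adj.symm⟩

theorem adj_of_dir (h : G.dir u v) : G.Adj u v :=
  ⟨.fwd, h⟩

theorem adj_of_bi (h : G.bi u v) : G.Adj u v :=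
  ⟨.arc, h⟩

theorem Into.adj (h : G.Into u v) : G.Adj u v :=
  h.elim adj_of_dir adj_of_bi

theorem not_adj_self (G : LMG V) (u : V) : ¬ G.Adj u u := by
  rw [adj_iff]
  rintro (h | h | h | h)
  exacts [G.und_irrefl _ h, G.bi_irrefl _ h, G.dir_irrefl _ h, G.dir_irrefl _ h]

theorem Adj.ne (h : G.Adj u v) : u ≠ v := by
  rintro rfl
  exact G.not_adj_self _ h

theorem isAncestor_of_dir (h : G.dir u v) : G.IsAncestor u v :=
  .single h

theorem isCollider_iff : G.IsCollider i j k ↔ i ≠ k ∧ G.Into i j ∧ G.Into k j :=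
  Iff.rfl

theorem IsCollider.symm (h : G.IsCollider i j k) : G.IsCollider k j i :=
  ⟨h.1.symm, h.2.2, h.2.1⟩

namespace IsAncestral

theorem not_isAncestor_of_into (hG : G.IsAncestral) (h : G.Into u v) : ¬ G.IsAncestor v u := by
  intro hvu
  rcases h with h | h
  · exact hG.no_directed_cycle u (.trans (isAncestor_of_dir h) hvu)
  · exact (hG.bi_no_directed_path u v h).2 hvu

theorem not_into_of_dir (hG : G.IsAncestral) (h : G.dir u v) : ¬ G.Into v u :=
  fun hvu => hG.not_isAncestor_of_into hvu (isAncestor_of_dir h)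

theorem not_und_of_into (hG : G.IsAncestral) (h : G.Into u v) : ¬ G.und v w := by
  intro hvw
  obtain ⟨hdir, hbi, -⟩ := hG.und_no_arrowhead v w hvw u
  exact h.elim hdir hbi

theorem dir_of_not_into (hG : G.IsAncestral) (h : G.Into w u) (huv : G.Adj u v)
    (hvu : ¬ G.Into v u) : G.dir u v := by
  rcases adj_iff.1 huv with hund | hbi | hdir | hdir
  · exact (hG.not_und_of_into h hund).elim
  · exact (hvu (.inr (G.bi_symm hbi))).elim
  · exact hdir
  · exact (hvu (.inl hdir)).elim

theorem dir_of_isAncestor (hG : G.IsAncestral) (h : G.IsAncestor u v) (huv : G.Adj u v) :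
    G.dir u v := by
  obtain ⟨w, -, hwv⟩ := Relation.TransGen.tail'_iff.1 h
  rcases adj_iff.1 huv with hund | hbi | hdir | hdir
  · exact (hG.not_und_of_into (.inl hwv) (G.und_symm hund)).elim
  · exact (hG.not_isAncestor_of_into (.inr (G.bi_symm hbi)) h).elim
  · exact hdir
  · exact (hG.not_isAncestor_of_into (.inl hdir) h).elim

theorem into_of_into_of_dir (hG : G.IsAncestral) (hab : G.Into a b) (hbc : G.dir b c)
    (hac : G.Adj a c) : G.Into a c := by
  rcases adj_iff.1 hac with hund | hbi | hdir | hdir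
  · exact (hG.not_und_of_into (.inl hbc) (G.und_symm hund)).elim
  · exact .inr hbi
  · exact .inl hdir
  · exact (hG.not_isAncestor_of_into hab
      (.trans (isAncestor_of_dir hbc) (isAncestor_of_dir hdir))).elim

theorem bi_of_into_of_into (hG : G.IsAncestral) (huv : G.Into u v) (hvu : G.Into v u) :
    G.bi u v :=
  huv.resolve_left fun hdir => hG.not_into_of_dir hdir hvu

theorem isSimple (hG : G.IsAncestral) : G.IsSimple := by
  intro u v κ κ' h h'
  have hline : G.und u v → ¬ G.Into v u := fun hund hvu => hG.not_und_of_into hvu hund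
  have hline' : G.und v u → ¬ G.Into u v := fun hund huv => hG.not_und_of_into huv hund
  have hfwd : G.dir u v → ¬ G.Into v u := hG.not_into_of_dir
  have hfwd' : G.dir v u → ¬ G.Into u v := hG.not_into_of_dir
  have hund := @G.und_symm u v
  have hbi := @G.bi_symm u v
  cases κ <;> cases κ' <;> simp only [HasEdge, Into] at * <;> tauto

end IsAncestral

theorem IsSimple.arrowAtEnd_iff (hG : G.IsSimple) {κ : EdgeKind} (h : G.HasEdge κ u v) :
    κ.ArrowAtEnd ↔ G.Into u v := by
  constructor
  · intro hκ
    cases κ <;> simp_all [EdgeKind.ArrowAtEnd, HasEdge, Into]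
  · rintro (hdir | hbi)
    · rw [hG h (κ' := .fwd) hdir]
      trivial
    · rw [hG h (κ' := .arc) hbi]
      trivial

theorem IsSimple.arrowAtStart_iff (hG : G.IsSimple) {κ : EdgeKind} (h : G.HasEdge κ u v) :
    κ.ArrowAtStart ↔ G.Into v u := by
  constructor
  · intro hκ
    cases κ
    · exact hκ.elim
    · exact .inr (G.bi_symm h)
    · exact hκ.elim
    · exact .inl h
  · rintro (hdir | hbi)
    · rw [hG h (κ' := .bwd) hdir]
      trivial
    · rw [hG h (κ' := .arc) (G.bi_symm hbi)]
      trivial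

end Arrowheads

section NodePaths

variable {V : Type*} {G H : LMG V} {C : Set V} {m n : ℕ} {v v' : ℕ → V} {c x y : V}

/-! ### Paths in simple graphs -/

/-- The nodes `v 0, …, v n` are those of a path. In a simple graph they determine its edges, so that
paths can be described by their nodes alone. -/
structure IsNodePath (G : LMG V) (n : ℕ) (v : ℕ → V) : Prop where
  adj : ∀ k < n, G.Adj (v k) (v (k + 1))
  inj : ∀ k ≤ n, ∀ l ≤ n, v k = v l → k = l

namespace IsNodePath

theorem ne {k l : ℕ} (h : G.IsNodePath n v) (hk : k ≤ n) (hl : l ≤ n) (hkl : k ≠ l) : v k ≠ v l :=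
  fun he => hkl (h.inj k hk l hl he)

theorem segment (h : G.IsNodePath n v) {j : ℕ} (hj : j + m ≤ n) :
    G.IsNodePath m (fun k => v (j + k)) where
  adj k hk := h.adj (j + k) (by omega)
  inj k hk l hl he := by
    have := h.inj (j + k) (by omega) (j + l) (by omega) he
    omega

theorem reverse (h : G.IsNodePath n v) : G.IsNodePath n (fun k => v (n - k)) where
  adj k hk := by
    have := (h.adj (n - (k + 1)) (by omega)).symm
    rwa [show n - (k + 1) + 1 = n - k by omega] at this
  inj k hk l hl he := by
    have := h.inj _ (by omega) _ (by omega) he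
    omega

theorem congr (h : G.IsNodePath n v) (hv : ∀ k ≤ n, v' k = v k) : G.IsNodePath n v' where
  adj k hk := by
    rw [hv k (by omega), hv (k + 1) (by omega)]
    exact h.adj k hk
  inj k hk l hl he := by
    rw [hv k hk, hv l hl] at he
    exact h.inj k hk l hl he

theorem isCollider_iff (h : G.IsNodePath n v) {k : ℕ} (hk : k + 1 < n) :
    H.IsCollider (v k) (v (k + 1)) (v (k + 2)) ↔
      H.Into (v k) (v (k + 1)) ∧ H.Into (v (k + 2)) (v (k + 1)) :=
  and_iff_right (h.ne (by omega) hk (by omega))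

end IsNodePath

theorem exists_isPath_iff : (∃ e, G.IsPath n v e) ↔ G.IsNodePath n v := by
  constructor
  · rintro ⟨e, hedge, hinj⟩
    exact ⟨fun k hk => ⟨e k, hedge k hk⟩, hinj⟩
  · intro h
    have : Nonempty EdgeKind := ⟨.line⟩
    choose! e he using h.adj
    exact ⟨e, he, h.inj⟩

theorem IsSimple.colliderAt_iff (hG : G.IsSimple) {e : ℕ → EdgeKind} (h : G.IsPath n v e) {k : ℕ}
    (hk : k + 1 < n) : ColliderAt e k ↔ G.IsCollider (v k) (v (k + 1)) (v (k + 2)) := by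
  rw [ColliderAt, hG.arrowAtEnd_iff (h.1 k (by omega)), hG.arrowAtStart_iff (h.1 (k + 1) hk)]
  exact ((exists_isPath_iff.1 ⟨e, h⟩).isCollider_iff hk).symm

/-- The path with the nodes `v 0, …, v n` is m-connecting given `C`. -/
structure NodeConnecting (G : LMG V) (C : Set V) (n : ℕ) (v : ℕ → V) : Prop where
  isNodePath : G.IsNodePath n v
  mem : ∀ k, k + 1 < n → G.IsCollider (v k) (v (k + 1)) (v (k + 2)) →
    v (k + 1) ∈ C ∪ G.ancestors C
  notMem : ∀ k, k + 1 < n → ¬ G.IsCollider (v k) (v (k + 1)) (v (k + 2)) → v (k + 1) ∉ C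
  start_notMem : v 0 ∉ C
  end_notMem : v n ∉ C

namespace NodeConnecting

theorem transfer (h : G.NodeConnecting C n v) (hadj : ∀ k < n, H.Adj (v k) (v (k + 1)))
    (hcol : ∀ k, k + 1 < n →
      (G.IsCollider (v k) (v (k + 1)) (v (k + 2)) ↔ H.IsCollider (v k) (v (k + 1)) (v (k + 2))))
    (hmem : ∀ k, k + 1 < n → G.IsCollider (v k) (v (k + 1)) (v (k + 2)) →
      v (k + 1) ∈ C ∪ H.ancestors C) : H.NodeConnecting C n v where
  isNodePath := ⟨hadj, h.isNodePath.inj⟩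
  mem k hk hc := hmem k hk ((hcol k hk).2 hc)
  notMem k hk hc := h.notMem k hk (mt (hcol k hk).1 hc)
  start_notMem := h.start_notMem
  end_notMem := h.end_notMem

theorem reverse (h : G.NodeConnecting C n v) : G.NodeConnecting C n (fun k => v (n - k)) where
  isNodePath := h.isNodePath.reverse
  mem k hk hc := by
    have := h.mem (n - (k + 2)) (by omega)
    rw [show n - (k + 2) + 1 = n - (k + 1) by omega, show n - (k + 2) + 2 = n - k by omega] at this
    exact this hc.symm
  notMem k hk hc := by
    have := h.notMem (n - (k + 2)) (by omega)
    rw [show n - (k + 2) + 1 = n - (k + 1) by omega, show n - (k + 2) + 2 = n - k by omega] at this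
    exact this (mt IsCollider.symm hc)
  start_notMem := by simpa using h.end_notMem
  end_notMem := by simpa using h.start_notMem

end NodeConnecting

theorem IsSimple.exists_mConnecting_iff (hG : G.IsSimple) :
    (∃ e, G.MConnecting C n v e) ↔ G.NodeConnecting C n v := by
  constructor
  · rintro ⟨e, hp, hmem, hnotMem, h0, hn⟩
    exact ⟨exists_isPath_iff.1 ⟨e, hp⟩, fun k hk h => hmem k hk ((hG.colliderAt_iff hp hk).2 h),
      fun k hk h => hnotMem k hk (mt (hG.colliderAt_iff hp hk).1 h), h0, hn⟩
  · rintro ⟨hp, hmem, hnotMem, h0, hn⟩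
    obtain ⟨e, hp⟩ := exists_isPath_iff.2 hp
    exact ⟨e, hp, fun k hk h => hmem k hk ((hG.colliderAt_iff hp hk).1 h),
      fun k hk h => hnotMem k hk (mt (hG.colliderAt_iff hp hk).2 h), h0, hn⟩

/-- `⟨v 0, …, v (m + 1), c⟩` is a discriminating path for `v (m + 1)`. The last node is kept apart
from the sequence, so that initial segments of a discriminating path are discriminating paths with
the same `v` and `c`. -/
structure NodeDiscriminating (G : LMG V) (m : ℕ) (v : ℕ → V) (c : V) : Prop where
  isNodePath : G.IsNodePath (m + 1) v
  start_ne : v 0 ≠ c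
  adj_end : G.Adj (v (m + 1)) c
  not_adj : ¬ G.Adj (v 0) c
  isCollider : ∀ k < m, G.IsCollider (v k) (v (k + 1)) (v (k + 2))
  dir : ∀ k < m, G.dir (v (k + 1)) c

namespace NodeDiscriminating

theorem ne_end (h : G.NodeDiscriminating m v c) {k : ℕ} (hk : k ≤ m + 1) : v k ≠ c := by
  rcases k with _ | k
  · exact h.start_ne
  · rcases Nat.lt_or_ge k m with hkm | hkm
    · exact (adj_of_dir (h.dir k hkm)).ne
    · obtain rfl : k = m := by omega
      exact h.adj_end.ne

theorem congr (h : G.NodeDiscriminating m v c) (hv : ∀ k ≤ m + 1, v' k = v k) :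
    G.NodeDiscriminating m v' c where
  isNodePath := h.isNodePath.congr hv
  start_ne := by simpa only [hv 0 (by omega)] using h.start_ne
  adj_end := by simpa only [hv (m + 1) le_rfl] using h.adj_end
  not_adj := by simpa only [hv 0 (by omega)] using h.not_adj
  isCollider k hk := by
    rw [hv k (by omega), hv (k + 1) (by omega), hv (k + 2) (by omega)]
    exact h.isCollider k hk
  dir k hk := by
    rw [hv (k + 1) (by omega)]
    exact h.dir k hk

theorem isNodePath_end (h : G.NodeDiscriminating m v (v (m + 2))) : G.IsNodePath (m + 2) v where
  adj k hk := by
    rcases Nat.lt_or_ge k (m + 1) with hkm | hkm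
    · exact h.isNodePath.adj k hkm
    · obtain rfl : k = m + 1 := by omega
      exact h.adj_end
  inj k hk l hl he := by
    rcases Nat.le_or_eq_of_le_succ hk with hk | rfl <;>
      rcases Nat.le_or_eq_of_le_succ hl with hl | rfl
    · exact h.isNodePath.inj k hk l hl he
    · exact (h.ne_end hk he).elim
    · exact (h.ne_end hl he.symm).elim
    · rfl

end NodeDiscriminating

theorem IsSimple.exists_isDiscriminatingPath_iff (hG : G.IsSimple) :
    (∃ e, G.IsDiscriminatingPath m v e) ↔ G.NodeDiscriminating m v (v (m + 2)) := by
  constructor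
  · rintro ⟨e, hp, hnadj, h⟩
    have hp' := exists_isPath_iff.1 ⟨e, hp⟩
    exact ⟨by simpa using hp'.segment (m := m + 1) (j := 0) (by omega),
      hp'.ne (by omega) le_rfl (by omega), hp'.adj _ (by omega), hnadj,
      fun k hk => (hG.colliderAt_iff hp (by omega)).1 (h k hk).1, fun k hk => (h k hk).2⟩
  · intro h
    obtain ⟨e, hp⟩ := exists_isPath_iff.2 h.isNodePath_end
    exact ⟨e, hp, h.not_adj, fun k hk =>
      ⟨(hG.colliderAt_iff hp (by omega)).2 (h.isCollider k hk), h.dir k hk⟩⟩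

/-- The path with the nodes `v 0, …, v n` is an inducing path. -/
structure NodeInducing (G : LMG V) (n : ℕ) (v : ℕ → V) : Prop where
  isNodePath : G.IsNodePath n v
  isCollider : ∀ k, k + 1 < n → G.IsCollider (v k) (v (k + 1)) (v (k + 2))
  isAncestor : ∀ k, k + 1 < n →
    G.IsAncestor (v (k + 1)) (v 0) ∨ G.IsAncestor (v (k + 1)) (v n)

theorem IsSimple.exists_isInducingPath_iff (hG : G.IsSimple) :
    (∃ e, G.IsInducingPath n v e) ↔ G.NodeInducing n v := by
  constructor
  · rintro ⟨e, hp, h⟩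
    exact ⟨exists_isPath_iff.1 ⟨e, hp⟩, fun k hk => (hG.colliderAt_iff hp hk).1 (h k hk).1,
      fun k hk => (h k hk).2⟩
  · rintro ⟨hp, hc, ha⟩
    obtain ⟨e, hp⟩ := exists_isPath_iff.2 hp
    exact ⟨e, hp, fun k hk => ⟨(hG.colliderAt_iff hp hk).2 (hc k hk), ha k hk⟩⟩

theorem NodeInducing.reverse (h : G.NodeInducing n v) :
    G.NodeInducing n (fun k => v (n - k)) where
  isNodePath := h.isNodePath.reverse
  isCollider k hk := by
    have := (h.isCollider (n - (k + 2)) (by omega)).symm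
    rwa [show n - (k + 2) + 1 = n - (k + 1) by omega,
      show n - (k + 2) + 2 = n - k by omega] at this
  isAncestor k hk := by
    have := (h.isAncestor (n - (k + 2)) (by omega)).symm
    rw [show n - (k + 2) + 1 = n - (k + 1) by omega] at this
    simpa only [Nat.sub_zero, Nat.sub_self] using this

theorem IsSimple.inducingConnected_iff (hG : G.IsSimple) :
    G.InducingConnected x y ↔ ∃ n v, G.NodeInducing n v ∧ v 0 = x ∧ v n = y := by
  constructor
  · rintro ⟨n, v, e, h, ⟨h0, hn⟩ | ⟨h0, hn⟩⟩
    · exact ⟨n, v, hG.exists_isInducingPath_iff.1 ⟨e, h⟩, h0, hn⟩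
    · exact ⟨n, _, (hG.exists_isInducingPath_iff.1 ⟨e, h⟩).reverse, by simpa using hn,
        by simpa using h0⟩
  · rintro ⟨n, v, h, h0, hn⟩
    obtain ⟨e, h⟩ := hG.exists_isInducingPath_iff.2 h
    exact ⟨n, v, e, h, .inl ⟨h0, hn⟩⟩

/-- Two nodes are joined by an m-connecting path. -/
def MConnected (G : LMG V) (C : Set V) (x y : V) : Prop :=
  ∃ n v e, v 0 = x ∧ v n = y ∧ G.MConnecting C n v e

theorem IsSimple.mConnected_iff (hG : G.IsSimple) :
    G.MConnected C x y ↔ ∃ n v, v 0 = x ∧ v n = y ∧ G.NodeConnecting C n v := by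
  simp only [MConnected, exists_and_left, hG.exists_mConnecting_iff]

theorem mem_indepModel_iff {A B : Set V} :
    (A, B, C) ∈ G.indepModel ↔
      Disjoint A B ∧ ∀ x ∈ A, ∀ y ∈ B, ¬ G.MConnected C x y := by
  refine and_congr_right fun _ => ⟨?_, ?_⟩
  · rintro h x hx y hy ⟨n, v, e, rfl, rfl, hc⟩
    exact h n v e hx hy hc
  · intro h n v e hx hy hc
    exact h _ hx _ hy ⟨n, v, e, rfl, rfl, hc⟩

theorem markovEquiv_iff :
    G.MarkovEquiv H ↔ ∀ C x y, x ≠ y → (G.MConnected C x y ↔ H.MConnected C x y) := by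
  constructor
  · intro h C x y hxy
    have hmem : (({x}, {y}, C) : Set V × Set V × Set V) ∈ G.indepModel ↔
        ({x}, {y}, C) ∈ H.indepModel := by
      rw [show G.indepModel = H.indepModel from h]
    simpa [mem_indepModel_iff, hxy, not_iff_not] using hmem
  · intro h
    refine Set.ext ?_
    rintro ⟨A, B, C⟩
    rw [mem_indepModel_iff, mem_indepModel_iff]
    refine and_congr_right fun hd => forall₂_congr fun x hx => forall₂_congr fun y hy => ?_
    rw [h C x y (hd.ne_of_mem hx hy)]

end NodePaths

section Walks

variable {V : Type*} {G : LMG V} {C : Set V} {a b b' : Prop} {j k l n p q s t : ℕ} {u x y z : V}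
  {v : ℕ → V} {w : ℕ → ℕ}

/-! ### Connecting walks -/

/-- There is a directed walk with `k` edges from `u` to a member of `C`. -/
def ReachesIn (G : LMG V) (C : Set V) : ℕ → V → Prop
  | 0, u => u ∈ C
  | k + 1, u => ∃ z, G.dir u z ∧ G.ReachesIn C k z

theorem exists_reachesIn_of_isAncestor (h : G.IsAncestor u z) (hz : ∃ k, G.ReachesIn C k z) :
    ∃ k, G.ReachesIn C k u := by
  induction h using Relation.TransGen.head_induction_on with
  | single hdir =>
    obtain ⟨k, hk⟩ := hz
    exact ⟨k + 1, _, hdir, hk⟩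
  | head hdir _ ih =>
    obtain ⟨k, hk⟩ := ih
    exact ⟨k + 1, _, hdir, hk⟩

theorem ReachesIn.mem_union_ancestors (h : G.ReachesIn C k u) : u ∈ C ∪ G.ancestors C := by
  induction k generalizing u with
  | zero => exact .inl h
  | succ k ih =>
    obtain ⟨z, huz, hz⟩ := h
    rcases ih hz with hz | ⟨y, hy, hzy⟩
    · exact .inr ⟨z, hz, isAncestor_of_dir huz⟩
    · exact .inr ⟨y, hy, .trans (isAncestor_of_dir huz) hzy⟩

theorem exists_reachesIn_iff : (∃ k, G.ReachesIn C k u) ↔ u ∈ C ∪ G.ancestors C := by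
  refine ⟨fun ⟨k, h⟩ => h.mem_union_ancestors, ?_⟩
  rintro (h | ⟨z, hz, h⟩)
  · exact ⟨0, h⟩
  · exact exists_reachesIn_of_isAncestor h ⟨0, hz⟩

/-- A walk may pass through `u` given `C`, where `a` and `b` say whether its two edges at `u` have
an arrowhead there. The weight `k` is the length of a directed walk from `u` to `C` if `u` is a
collider on the walk, and `0` otherwise. -/
def CanPass (G : LMG V) (C : Set V) (u : V) (a b : Prop) (k : ℕ) : Prop :=
  (a ∧ b ∧ G.ReachesIn C k u) ∨ (¬ (a ∧ b) ∧ u ∉ C ∧ k = 0)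

theorem canPass_of_notMem (hab : ¬ (a ∧ b)) (hu : u ∉ C) : G.CanPass C u a b 0 :=
  .inr ⟨hab, hu, rfl⟩

theorem canPass_of_reachesIn (ha : a) (hb : b) (hu : G.ReachesIn C k u) : G.CanPass C u a b k :=
  .inl ⟨ha, hb, hu⟩

theorem exists_canPass_of_mem (ha : a) (hb : b) (hu : u ∈ C ∪ G.ancestors C) :
    ∃ k, G.CanPass C u a b k :=
  (exists_reachesIn_iff.2 hu).imp fun _ => canPass_of_reachesIn ha hb

namespace CanPass

theorem symm (h : G.CanPass C u a b k) : G.CanPass C u b a k := by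
  unfold CanPass at *
  tauto

theorem reachesIn (h : G.CanPass C u a b k) (ha : a) (hb : b) : G.ReachesIn C k u := by
  unfold CanPass at h
  tauto

theorem notMem (h : G.CanPass C u a b k) (hab : ¬ (a ∧ b)) : u ∉ C := by
  unfold CanPass at h
  tauto

theorem congr_of_not (h : G.CanPass C u a b k) (hab : ¬ (a ∧ b)) (hab' : ¬ (a ∧ b')) :
    G.CanPass C u a b' k := by
  unfold CanPass at *
  tauto

end CanPass

/-- A walk from `x` to `u` with `n` edges whose nodes before `u` may be passed given `C` and have
total weight `s`; `a` says whether its last edge has an arrowhead at `u`. -/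
inductive Trail (G : LMG V) (C : Set V) (x : V) : ℕ → ℕ → V → Prop → Prop
  | nil : Trail G C x 0 0 x False
  | step {n s k : ℕ} {u z : V} {a : Prop} : Trail G C x n s u a → G.Adj u z →
      G.CanPass C u a (G.Into z u) k → Trail G C x (n + 1) (s + k) z (G.Into u z)

/-- The edge before `v k` has an arrowhead at `v k`. -/
def ArrowBefore (G : LMG V) (v : ℕ → V) (k : ℕ) : Prop :=
  0 < k ∧ G.Into (v (k - 1)) (v k)

/-- The edge after `v k` has an arrowhead at `v k`. -/
def ArrowAfter (G : LMG V) (n : ℕ) (v : ℕ → V) (k : ℕ) : Prop :=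
  k < n ∧ G.Into (v (k + 1)) (v k)

theorem arrowBefore_zero (G : LMG V) (v : ℕ → V) : G.ArrowBefore v 0 = False := by
  simp [ArrowBefore]

theorem arrowBefore_succ (G : LMG V) (v : ℕ → V) (k : ℕ) :
    G.ArrowBefore v (k + 1) = G.Into (v k) (v (k + 1)) := by
  simp [ArrowBefore]

theorem arrowAfter_self (G : LMG V) (n : ℕ) (v : ℕ → V) : G.ArrowAfter n v n = False := by
  simp [ArrowAfter]

theorem arrowAfter_of_lt (hk : k < n) : G.ArrowAfter n v k = G.Into (v (k + 1)) (v k) := by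
  simp [ArrowAfter, hk]

theorem arrowBefore_reverse (hk : k ≤ n) :
    G.ArrowBefore (fun l => v (n - l)) k = G.ArrowAfter n v (n - k) := by
  refine propext (and_congr_right_iff.2 (fun hk => ?_) |>.trans (and_congr_left_iff.2 ?_))
  · simp only [show n - (k - 1) = n - k + 1 by omega]
  · intro _
    omega

theorem arrowAfter_reverse (hk : k ≤ n) :
    G.ArrowAfter n (fun l => v (n - l)) k = G.ArrowBefore v (n - k) := by
  refine propext (and_congr_right_iff.2 (fun _ => ?_) |>.trans (and_congr_left_iff.2 ?_))
  · simp only [show n - (k + 1) = n - k - 1 by omega]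
  · intro _
    omega

/-- A walk with the nodes `v 0, …, v n` that is m-connecting given `C`, where `w k` is the weight
of the node `v k` as in `CanPass`. -/
structure IsConnectingWalk (G : LMG V) (C : Set V) (n : ℕ) (v : ℕ → V) (w : ℕ → ℕ) : Prop where
  adj : ∀ k < n, G.Adj (v k) (v (k + 1))
  canPass : ∀ k ≤ n, G.CanPass C (v k) (G.ArrowBefore v k) (G.ArrowAfter n v k) (w k)

namespace IsConnectingWalk

theorem reverse (h : G.IsConnectingWalk C n v w) :
    G.IsConnectingWalk C n (fun k => v (n - k)) (fun k => w (n - k)) where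
  adj k hk := by
    have := (h.adj (n - (k + 1)) (by omega)).symm
    rwa [show n - (k + 1) + 1 = n - k by omega] at this
  canPass k hk := by
    rw [arrowBefore_reverse hk, arrowAfter_reverse hk]
    exact (h.canPass (n - k) (by omega)).symm

theorem trail (h : G.IsConnectingWalk C n v w) (hk : k ≤ n) :
    G.Trail C (v 0) k (∑ i ∈ Finset.range k, w i) (v k) (G.ArrowBefore v k) := by
  induction k with
  | zero =>
    rw [arrowBefore_zero]
    exact .nil
  | succ k ih =>
    have hpass := h.canPass k (by omega)
    rw [arrowAfter_of_lt hk] at hpass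
    rw [Finset.sum_range_succ, arrowBefore_succ]
    exact .step (ih (by omega)) (h.adj k hk) hpass

theorem trail_reverse (h : G.IsConnectingWalk C n v w) (hk : k ≤ n) :
    G.Trail C (v n) (n - k) (∑ i ∈ Finset.range (n - k), w (n - i)) (v k)
      (G.ArrowAfter n v k) := by
  have := h.reverse.trail (k := n - k) (by omega)
  rw [arrowBefore_reverse (by omega)] at this
  simpa only [show n - (n - k) = k by omega, Nat.sub_zero] using this

end IsConnectingWalk

theorem Trail.exists_concat (h : G.Trail C x p s u a) (h' : G.Trail C y q t u b)
    (hpass : G.CanPass C u a b k) :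
    ∃ s' k' a', G.Trail C x (p + q) s' y a' ∧ G.CanPass C y a' False k' ∧
      s' + k' = s + k + t := by
  induction h' generalizing p s a k with
  | nil => exact ⟨s, k, a, h, hpass, rfl⟩
  | @step n t l z u b _ hadj hz ih =>
    obtain ⟨s', k', a', htrail, hpass', hsum⟩ := ih (.step h hadj.symm hpass) hz.symm
    refine ⟨s', k', a', ?_, hpass', by omega⟩
    rwa [show p + (n + 1) = p + 1 + n by omega]

theorem Trail.exists_nodes (h : G.Trail C x n s u a) :
    ∃ (v : ℕ → V) (w : ℕ → ℕ), v 0 = x ∧ v n = u ∧ a = G.ArrowBefore v n ∧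
      (∀ k < n, G.Adj (v k) (v (k + 1)) ∧
        G.CanPass C (v k) (G.ArrowBefore v k) (G.Into (v (k + 1)) (v k)) (w k)) ∧
      ∑ i ∈ Finset.range n, w i = s := by
  induction h with
  | nil => exact ⟨fun _ => x, fun _ => 0, rfl, rfl, (arrowBefore_zero G _).symm, by simp, by simp⟩
  | @step n s l u z a _ hadj hpass ih =>
    obtain ⟨v, w, rfl, rfl, rfl, hv, hsum⟩ := ih
    have hupdate : ∀ k ≤ n, Function.update v (n + 1) z k = v k := fun k hk =>
      Function.update_of_ne (by omega) _ _
    have hbefore : ∀ k ≤ n, G.ArrowBefore (Function.update v (n + 1) z) k = G.ArrowBefore v k :=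
      fun k hk => by rw [ArrowBefore, ArrowBefore, hupdate k hk, hupdate (k - 1) (by omega)]
    have hweight : ∀ k < n, Function.update w n l k = w k := fun k hk =>
      Function.update_of_ne (by omega) _ _
    refine ⟨Function.update v (n + 1) z, Function.update w n l, hupdate 0 (by omega), by simp, ?_,
      fun k hk => ?_, ?_⟩
    · rw [arrowBefore_succ, hupdate n le_rfl, Function.update_self]
    · rw [hupdate k (by omega), hbefore k (by omega)]
      rcases Nat.lt_succ_iff_lt_or_eq.1 hk with hk | rfl
      · rw [hupdate (k + 1) hk, hweight k hk]
        exact hv k hk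
      · simpa only [Function.update_self] using And.intro hadj hpass
    · rw [Finset.sum_range_succ, Function.update_self,
        Finset.sum_congr rfl fun i hi => hweight i (Finset.mem_range.1 hi), hsum]

theorem Trail.exists_isConnectingWalk (h : G.Trail C x p s u a) (h' : G.Trail C y q t u b)
    (hpass : G.CanPass C u a b k) :
    ∃ v w, v 0 = x ∧ v (p + q) = y ∧ G.IsConnectingWalk C (p + q) v w ∧
      ∑ i ∈ Finset.range (p + q + 1), w i = s + k + t := by
  obtain ⟨s', k', a', htrail, hend, hsum⟩ := h.exists_concat h' hpass
  obtain ⟨v, w, rfl, rfl, rfl, hv, hs⟩ := htrail.exists_nodes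
  have hweight : ∀ i < p + q, Function.update w (p + q) k' i = w i := fun i hi =>
    Function.update_of_ne (by omega) _ _
  refine ⟨v, Function.update w (p + q) k', rfl, rfl, ⟨fun i hi => (hv i hi).1, fun i hi => ?_⟩, ?_⟩
  · rcases hi.lt_or_eq with hi | rfl
    · rw [hweight i hi, arrowAfter_of_lt hi]
      exact (hv i hi).2
    · rw [arrowAfter_self, Function.update_self]
      exact hend
  · rw [Finset.sum_range_succ, Finset.sum_congr rfl fun i hi => hweight i (Finset.mem_range.1 hi),
      hs, Function.update_self, hsum]

/-- A connecting walk between distinct endpoints that has the fewest edges, and among these walks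
the least total weight. Its competitors are described by two trails from the endpoints that meet in
a node. -/
structure IsMinimalWalk (G : LMG V) (C : Set V) (n : ℕ) (v : ℕ → V) (w : ℕ → ℕ) : Prop extends
    G.IsConnectingWalk C n v w where
  ne : v 0 ≠ v n
  length_le : ∀ ⦃p q s t u a b k⦄, G.Trail C (v 0) p s u a → G.Trail C (v n) q t u b →
    G.CanPass C u a b k → n ≤ p + q
  weight_le : ∀ ⦃p q s t u a b k⦄, G.Trail C (v 0) p s u a → G.Trail C (v n) q t u b →
    G.CanPass C u a b k → p + q = n → ∑ i ∈ Finset.range (n + 1), w i ≤ s + k + t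

theorem IsConnectingWalk.exists_isMinimalWalk (h : G.IsConnectingWalk C n v w) (hne : v 0 ≠ v n) :
    ∃ n' v' w', G.IsMinimalWalk C n' v' w' ∧ v' 0 = v 0 ∧ v' n' = v n := by
  classical
  have hlength : ∃ m, ∃ v' w', v' 0 = v 0 ∧ v' m = v n ∧ G.IsConnectingWalk C m v' w' :=
    ⟨n, v, w, rfl, rfl, h⟩
  set m := Nat.find hlength
  have hweight : ∃ s, ∃ v' w', v' 0 = v 0 ∧ v' m = v n ∧ G.IsConnectingWalk C m v' w' ∧
      ∑ i ∈ Finset.range (m + 1), w' i = s := by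
    obtain ⟨v', w', hstart, hend, hwalk⟩ := Nat.find_spec hlength
    exact ⟨_, v', w', hstart, hend, hwalk, rfl⟩
  obtain ⟨v', w', hstart, hend, hwalk, hsum⟩ := Nat.find_spec hweight
  refine ⟨m, v', w', ⟨hwalk, by rwa [hstart, hend], ?_, ?_⟩, hstart, hend⟩
  all_goals
    intro p q s t u a b k hp hq hpass
    rw [hstart] at hp
    rw [hend] at hq
    obtain ⟨v₁, w₁, hstart₁, hend₁, hwalk₁, hsum₁⟩ := hp.exists_isConnectingWalk hq hpass
  · exact Nat.find_min' hlength ⟨v₁, w₁, hstart₁, hend₁, hwalk₁⟩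
  · intro hpq
    rw [hpq] at hend₁ hwalk₁ hsum₁
    exact hsum.trans_le (Nat.find_min' hweight ⟨v₁, w₁, hstart₁, hend₁, hwalk₁, hsum₁⟩)

theorem IsMinimalWalk.reverse (h : G.IsMinimalWalk C n v w) :
    G.IsMinimalWalk C n (fun k => v (n - k)) (fun k => w (n - k)) where
  toIsConnectingWalk := h.toIsConnectingWalk.reverse
  ne := by simpa using h.ne.symm
  length_le p q s t u a b k hp hq hpass := by
    have := h.length_le (by simpa using hq) (by simpa using hp) hpass.symm
    omega
  weight_le p q s t u a b k hp hq hpass hpq := by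
    have hsum := Finset.sum_range_reflect w (n + 1)
    simp only [Nat.add_sub_cancel] at hsum
    rw [hsum]
    have := h.weight_le (by simpa using hq) (by simpa using hp) hpass.symm (by omega)
    omega

/-! ### From connecting walks to connecting paths -/

theorem IsAncestral.isAncestor_or_exists_collider (hG : G.IsAncestral)
    (hadj : ∀ l < n, G.Adj (v l) (v (l + 1))) (hdir : G.dir (v j) (v (j + 1))) (hjk : j < k)
    (hk : k ≤ n) :
    (G.IsAncestor (v j) (v k) ∧ G.Into (v (k - 1)) (v k)) ∨
      ∃ l, j < l ∧ l < k ∧ G.IsAncestor (v j) (v l) ∧ G.Into (v (l - 1)) (v l) ∧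
        G.Into (v (l + 1)) (v l) := by
  induction k, Nat.succ_le_of_lt hjk using Nat.le_induction with
  | base => exact .inl ⟨isAncestor_of_dir hdir, .inl hdir⟩
  | succ k hjk ih =>
    rcases ih (by omega) (by omega) with ⟨hanc, hinto⟩ | ⟨l, hjl, hlk, hl⟩
    · by_cases hback : G.Into (v (k + 1)) (v k)
      · exact .inr ⟨k, by omega, by omega, hanc, hinto, hback⟩
      · have hnext := hG.dir_of_not_into hinto (hadj k (by omega)) hback
        exact .inl ⟨.trans hanc (isAncestor_of_dir hnext), .inl hnext⟩
    · exact .inr ⟨l, hjl, by omega, hl⟩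

theorem IsConnectingWalk.exists_reachesIn_of_eq (hG : G.IsAncestral)
    (h : G.IsConnectingWalk C n v w) (hjk : j < k) (hk : k ≤ n) (heq : v j = v k)
    (hj : G.ArrowBefore v j) : ∃ r, G.ReachesIn C r (v j) := by
  by_cases hcol : G.ArrowAfter n v j
  · exact ⟨_, (h.canPass j (by omega)).reachesIn hj hcol⟩
  · have hdir : G.dir (v j) (v (j + 1)) :=
      hG.dir_of_not_into hj.2 (h.adj j (by omega)) fun hinto => hcol ⟨by omega, hinto⟩
    rcases hG.isAncestor_or_exists_collider h.adj hdir hjk hk with ⟨hcycle, -⟩ | ⟨l, hjl, hlk, hl⟩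
    · rw [← heq] at hcycle
      exact (hG.no_directed_cycle _ hcycle).elim
    · exact exists_reachesIn_of_isAncestor hl.1
        ⟨_, (h.canPass l (by omega)).reachesIn ⟨by omega, hl.2.1⟩ ⟨by omega, hl.2.2⟩⟩

theorem IsConnectingWalk.exists_canPass_of_eq (hG : G.IsAncestral)
    (h : G.IsConnectingWalk C n v w) (hjk : j < k) (hk : k ≤ n) (heq : v j = v k) :
    ∃ r, G.CanPass C (v j) (G.ArrowBefore v j) (G.ArrowAfter n v k) r := by
  by_cases hj : G.ArrowBefore v j
  · by_cases hk' : G.ArrowAfter n v k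
    · exact (h.exists_reachesIn_of_eq hG hjk hk heq hj).imp fun _ => canPass_of_reachesIn hj hk'
    · have hmem := (h.canPass k hk).notMem fun h' => hk' h'.2
      exact ⟨0, canPass_of_notMem (fun h' => hk' h'.2) (by rwa [heq])⟩
  · exact ⟨0, canPass_of_notMem (fun h' => hj h'.1)
      ((h.canPass j (by omega)).notMem fun h' => hj h'.1)⟩

theorem IsMinimalWalk.isNodePath (hG : G.IsAncestral) (h : G.IsMinimalWalk C n v w) :
    G.IsNodePath n v := by
  have hne : ∀ j k, j < k → k ≤ n → v j ≠ v k := by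
    intro j k hjk hk heq
    obtain ⟨r, hr⟩ := h.exists_canPass_of_eq hG hjk hk heq
    have htrail := h.toIsConnectingWalk.trail_reverse hk
    rw [← heq] at htrail
    have := h.length_le (h.toIsConnectingWalk.trail (by omega)) htrail hr
    omega
  refine ⟨h.adj, fun j hj k hk heq => ?_⟩
  rcases lt_trichotomy j k with hjk | hjk | hkj
  · exact (hne j k hjk hk heq).elim
  · exact hjk
  · exact (hne k j hkj hj heq.symm).elim

theorem NodeConnecting.exists_isConnectingWalk (h : G.NodeConnecting C n v) :
    ∃ w, G.IsConnectingWalk C n v w := by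
  have hpass : ∀ k ≤ n, ∃ r, G.CanPass C (v k) (G.ArrowBefore v k) (G.ArrowAfter n v k) r := by
    intro k hk
    rcases hk.lt_or_eq with hkn | rfl
    · rcases k with _ | k
      · exact ⟨0, canPass_of_notMem (by simp [arrowBefore_zero]) h.start_notMem⟩
      · rw [arrowBefore_succ, arrowAfter_of_lt hkn]
        by_cases hcol : G.IsCollider (v k) (v (k + 1)) (v (k + 2))
        · exact exists_canPass_of_mem hcol.2.1 hcol.2.2 (h.mem k hkn hcol)
        · exact ⟨0, canPass_of_notMem (mt (h.isNodePath.isCollider_iff hkn).2 hcol)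
            (h.notMem k hkn hcol)⟩
    · exact ⟨0, canPass_of_notMem (by simp [arrowAfter_self]) h.end_notMem⟩
  choose! w hw using hpass
  exact ⟨w, h.isNodePath.adj, hw⟩

theorem IsConnectingWalk.end_notMem (h : G.IsConnectingWalk C n v w) : v n ∉ C :=
  (h.canPass n le_rfl).notMem (by simp [arrowAfter_self])

theorem IsConnectingWalk.nodeConnecting (h : G.IsConnectingWalk C n v w) (hv : G.IsNodePath n v) :
    G.NodeConnecting C n v where
  isNodePath := hv
  mem k hk hcol := ((h.canPass (k + 1) hk.le).reachesIn ⟨k.succ_pos, hcol.2.1⟩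
    ⟨hk, hcol.2.2⟩).mem_union_ancestors
  notMem k hk hcol := (h.canPass (k + 1) hk.le).notMem fun h' =>
    hcol ((hv.isCollider_iff hk).2 ⟨h'.1.2, h'.2.2⟩)
  start_notMem := (h.canPass 0 n.zero_le).notMem (by simp [arrowBefore_zero])
  end_notMem := h.end_notMem

theorem IsAncestral.mConnected_iff_exists_isConnectingWalk (hG : G.IsAncestral) (hne : x ≠ y) :
    G.MConnected C x y ↔ ∃ n v w, v 0 = x ∧ v n = y ∧ G.IsConnectingWalk C n v w := by
  rw [hG.isSimple.mConnected_iff]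
  constructor
  · rintro ⟨n, v, hstart, hend, h⟩
    obtain ⟨w, hw⟩ := h.exists_isConnectingWalk
    exact ⟨n, v, w, hstart, hend, hw⟩
  · rintro ⟨n, v, w, rfl, rfl, h⟩
    obtain ⟨n', v', w', h', hstart, hend⟩ := h.exists_isMinimalWalk hne
    exact ⟨n', v', hstart, hend, h'.toIsConnectingWalk.nodeConnecting (h'.isNodePath hG)⟩

/-- There is a walk from `x` to `u` whose nodes before `u` may be passed given `C`; `a` says whether
its last edge has an arrowhead at `u`. -/
def HasTrail (G : LMG V) (C : Set V) (x u : V) (a : Prop) : Prop :=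
  ∃ n s, G.Trail C x n s u a

theorem HasTrail.nil (G : LMG V) (C : Set V) (x : V) : G.HasTrail C x x False :=
  ⟨0, 0, .nil⟩

theorem HasTrail.step (h : G.HasTrail C x u a) (hadj : G.Adj u z)
    (hpass : G.CanPass C u a (G.Into z u) k) : G.HasTrail C x z (G.Into u z) := by
  obtain ⟨n, s, h⟩ := h
  exact ⟨n + 1, s + k, h.step hadj hpass⟩

theorem IsAncestral.mConnected_iff_hasTrail (hG : G.IsAncestral) (hne : x ≠ y) :
    G.MConnected C x y ↔ y ∉ C ∧ ∃ a, G.HasTrail C x y a := by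
  rw [hG.mConnected_iff_exists_isConnectingWalk hne]
  constructor
  · rintro ⟨n, v, w, rfl, rfl, h⟩
    exact ⟨h.end_notMem, _, _, _, h.trail le_rfl⟩
  · rintro ⟨hy, a, n, s, h⟩
    obtain ⟨v, w, hstart, hend, hw, -⟩ :=
      h.exists_isConnectingWalk .nil (canPass_of_notMem And.right hy)
    exact ⟨_, v, w, hstart, hend, hw⟩

end Walks

section MaximalExtension

variable {V : Type*} {G : LMG V} {C : Set V} {a : Prop} {k n r : ℕ} {i j q t u x y z : V}
  {v : ℕ → V}

/-! ### Inducing paths and maximal extensions -/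

/-- An ancestral graph is maximal if any two distinct nodes joined by an inducing path are
adjacent. -/
def IsMaximal (G : LMG V) : Prop :=
  ∀ i j, i ≠ j → G.InducingConnected i j → G.Adj i j

namespace NodeInducing

theorem two_le (h : G.NodeInducing n v) (hne : v 0 ≠ v n) (hadj : ¬ G.Adj (v 0) (v n)) :
    2 ≤ n := by
  by_contra hn
  obtain rfl | rfl : n = 0 ∨ n = 1 := by omega
  · exact hne rfl
  · exact hadj (h.isNodePath.adj 0 one_pos)

theorem not_isAncestor (hG : G.IsAncestral) (h : G.NodeInducing n v) (hn : 2 ≤ n) :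
    ¬ G.IsAncestor (v 0) (v n) := by
  obtain ⟨n, rfl⟩ : ∃ m, n = m + 2 := ⟨n - 2, by omega⟩
  intro h0
  exact hG.not_isAncestor_of_into (h.isCollider n (by omega)).2.2
    ((h.isAncestor n (by omega)).elim (fun hstart => hstart.trans h0) id)

theorem bi_first (hG : G.IsAncestral) (h : G.NodeInducing n v) (hn : 2 ≤ n) :
    G.bi (v 0) (v 1) := by
  refine (h.isCollider 0 hn).2.1.resolve_left fun hdir => ?_
  have hanc := isAncestor_of_dir hdir
  exact (h.isAncestor 0 hn).elim (fun hstart => hG.no_directed_cycle _ (hanc.trans hstart))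
    fun hend => h.not_isAncestor hG hn (hanc.trans hend)

theorem bi (hG : G.IsAncestral) (h : G.NodeInducing n v) (hn : 2 ≤ n) (hk : k < n) :
    G.bi (v k) (v (k + 1)) := by
  rcases k with _ | k
  · exact h.bi_first hG hn
  · rcases (show k + 1 + 1 ≤ n by omega).lt_or_eq with hlt | rfl
    · exact hG.bi_of_into_of_into (h.isCollider (k + 1) hlt).2.1 (h.isCollider k hk).2.2
    · exact G.bi_symm (by simpa using h.reverse.bi_first hG hn)

theorem bi_last (hG : G.IsAncestral) (h : G.NodeInducing n v) (hn : 2 ≤ n) :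
    G.bi (v (n - 1)) (v n) := by
  have := h.bi hG hn (k := n - 1) (by omega)
  rwa [show n - 1 + 1 = n by omega] at this

end NodeInducing

theorem maximalExtension_reachesIn_iff :
    G.maximalExtension.ReachesIn C k u ↔ G.ReachesIn C k u := by
  induction k generalizing u with
  | zero => rfl
  | succ k ih => exact exists_congr fun w => and_congr Iff.rfl ih

theorem maximalExtension_canPass_iff {b : Prop} :
    G.maximalExtension.CanPass C u a b k ↔ G.CanPass C u a b k := by
  simp only [CanPass, maximalExtension_reachesIn_iff]

theorem maximalExtension_adj_iff :
    G.maximalExtension.Adj x y ↔ G.Adj x y ∨ (x ≠ y ∧ G.InducingConnected x y) := by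
  rw [adj_iff, adj_iff (G := G)]
  change G.und x y ∨ (G.bi x y ∨ x ≠ y ∧ ¬ G.Adj x y ∧ G.InducingConnected x y) ∨
    G.dir x y ∨ G.dir y x ↔ _
  rw [adj_iff]
  tauto

theorem maximalExtension_into_iff (h : G.Adj x y) : G.maximalExtension.Into x y ↔ G.Into x y :=
  or_congr_right (or_iff_left fun hnew => hnew.2.1 h)

theorem IsAncestral.not_isAncestor_of_maximalExtension_bi (hG : G.IsAncestral)
    (h : G.maximalExtension.bi x y) : ¬ G.IsAncestor x y := by
  rcases h with h | ⟨hne, hadj, hind⟩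
  · exact (hG.bi_no_directed_path x y h).1
  · obtain ⟨n, v, hv, rfl, rfl⟩ := hG.isSimple.inducingConnected_iff.1 hind
    exact hv.not_isAncestor hG (hv.two_le hne hadj)

theorem IsAncestral.exists_bi_of_maximalExtension_bi (hG : G.IsAncestral)
    (h : G.maximalExtension.bi x y) : ∃ z, G.bi z y := by
  rcases h with h | ⟨hne, hadj, hind⟩
  · exact ⟨x, h⟩
  · obtain ⟨n, v, hv, rfl, rfl⟩ := hG.isSimple.inducingConnected_iff.1 hind
    exact ⟨_, hv.bi_last hG (hv.two_le hne hadj)⟩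

theorem IsAncestral.maximalExtension (hG : G.IsAncestral) : G.maximalExtension.IsAncestral where
  no_directed_cycle := hG.no_directed_cycle
  bi_no_directed_path x y h := ⟨hG.not_isAncestor_of_maximalExtension_bi h,
    hG.not_isAncestor_of_maximalExtension_bi (G.maximalExtension.bi_symm h)⟩
  und_no_arrowhead x y h z := by
    have hbi : ∀ {x y}, G.und x y → ¬ G.maximalExtension.bi z x := fun {x y} hxy hzx => by
      obtain ⟨z', hz'⟩ := hG.exists_bi_of_maximalExtension_bi hzx
      exact (hG.und_no_arrowhead x y hxy z').2.1 hz'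
    obtain ⟨hx, -, hy, -⟩ := hG.und_no_arrowhead x y h z
    exact ⟨hx, hbi h, hy, hbi (G.und_symm h)⟩

namespace HasTrail

theorem step_bi (h : G.HasTrail C x u a) (hbi : G.bi u z) (hpass : G.CanPass C u a True k) :
    G.HasTrail C x z True := by
  rw [← eq_true (show G.Into z u from .inr (G.bi_symm hbi))] at hpass
  have := h.step (adj_of_bi hbi) hpass
  rwa [eq_true (show G.Into u z from .inr hbi)] at this

theorem step_dir (hG : G.IsAncestral) (h : G.HasTrail C x u a) (hdir : G.dir u z) (hu : u ∉ C) :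
    G.HasTrail C x z True := by
  have := h.step (adj_of_dir hdir)
    (canPass_of_notMem (fun hpass => hG.not_into_of_dir hdir hpass.2) hu)
  rwa [eq_true (show G.Into u z from .inl hdir)] at this

theorem step_dir_reverse (hG : G.IsAncestral) (h : G.HasTrail C x u a) (hdir : G.dir z u)
    (hpass : G.CanPass C u a True k) : G.HasTrail C x z False := by
  rw [← eq_true (show G.Into z u from .inl hdir)] at hpass
  have := h.step (adj_of_dir hdir).symm hpass
  rwa [eq_false (hG.not_into_of_dir hdir)] at this

theorem descend (hG : G.IsAncestral) (h : G.HasTrail C x q a) (hq : q ∉ C ∪ G.ancestors C)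
    (hqu : G.IsAncestor q u) : G.HasTrail C x u True := by
  induction hqu with
  | single hdir => exact h.step_dir hG hdir fun hmem => hq (.inl hmem)
  | tail hqp hdir ih => exact ih.step_dir hG hdir fun hmem => hq (.inr ⟨_, hmem, hqp⟩)

theorem ascend (hG : G.IsAncestral) (h : G.HasTrail C x u a) (hpass : G.CanPass C u a True k)
    (hq : q ∉ C ∪ G.ancestors C) (hqu : G.IsAncestor q u) : G.HasTrail C x q False := by
  induction hqu generalizing a k with
  | single hdir => exact h.step_dir_reverse hG hdir hpass
  | tail hqp hdir ih =>
    exact ih (h.step_dir_reverse hG hdir hpass)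
      (canPass_of_notMem And.left fun hmem => hq (.inr ⟨_, hmem, hqp⟩))

/-- If an inner node of an inducing path cannot be passed as a collider, then it is not an ancestor
of `C`, and one walks instead along directed edges from it to the end of the path, or from the
start of the path back to it. -/
theorem pass_inducing_node (hG : G.IsAncestral) (hv : G.NodeInducing n v)
    (hstart : G.HasTrail C x (v 0) a) (hpass : G.CanPass C (v 0) a True r) (hk : k + 1 < n)
    (h : G.HasTrail C x (v (k + 1)) True) :
    G.HasTrail C x (v n) True ∨
      ∃ a' r', G.HasTrail C x (v (k + 1)) a' ∧ G.CanPass C (v (k + 1)) a' True r' := by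
  by_cases hC : v (k + 1) ∈ C ∪ G.ancestors C
  · obtain ⟨r', hr'⟩ := exists_canPass_of_mem trivial trivial hC
    exact .inr ⟨True, r', h, hr'⟩
  · rcases hv.isAncestor k hk with hanc | hanc
    · exact .inr ⟨False, 0, hstart.ascend hG hpass hC hanc,
        canPass_of_notMem And.left fun hmem => hC (.inl hmem)⟩
    · exact .inl (h.descend hG hC hanc)

theorem along_inducing (hG : G.IsAncestral) (hv : G.NodeInducing n v) (hn : 2 ≤ n)
    (h : G.HasTrail C x (v 0) a) (hpass : G.CanPass C (v 0) a True r) :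
    G.HasTrail C x (v n) True := by
  by_contra hcon
  have hreach : ∀ k < n, ∃ a' r', G.HasTrail C x (v k) a' ∧ G.CanPass C (v k) a' True r' := by
    intro k hk
    induction k with
    | zero => exact ⟨a, r, h, hpass⟩
    | succ k ih =>
      obtain ⟨a', r', htrail, hpass'⟩ := ih (by omega)
      have hnext := htrail.step_bi (hv.bi hG hn (k := k) (by omega)) hpass'
      exact (h.pass_inducing_node hG hv hpass hk hnext).resolve_left hcon
  obtain ⟨a', r', htrail, hpass'⟩ := hreach (n - 1) (by omega)
  exact hcon (htrail.step_bi (hv.bi_last hG hn) hpass')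

theorem of_maximalExtension (hG : G.IsAncestral) (h : G.maximalExtension.HasTrail C x u a) :
    G.HasTrail C x u a := by
  obtain ⟨n, s, h⟩ := h
  induction h with
  | nil => exact .nil G C x
  | @step n s k u z a _ hadj hpass ih =>
    rw [maximalExtension_canPass_iff] at hpass
    by_cases huz : G.Adj u z
    · rw [maximalExtension_into_iff huz.symm] at hpass
      rw [maximalExtension_into_iff huz]
      exact ih.step huz hpass
    · obtain ⟨hne, hind⟩ := (maximalExtension_adj_iff.1 hadj).resolve_left huz
      have hbi : G.maximalExtension.bi u z := .inr ⟨hne, huz, hind⟩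
      rw [eq_true (show G.maximalExtension.Into z u from .inr (G.maximalExtension.bi_symm hbi))]
        at hpass
      rw [eq_true (show G.maximalExtension.Into u z from .inr hbi)]
      obtain ⟨m, v, hv, rfl, rfl⟩ := hG.isSimple.inducingConnected_iff.1 hind
      exact ih.along_inducing hG hv (hv.two_le hne huz) hpass

end HasTrail

theorem NodeConnecting.maximalExtension (h : G.NodeConnecting C n v) :
    G.maximalExtension.NodeConnecting C n v := by
  have hadj := h.isNodePath.adj
  refine h.transfer (fun k hk => maximalExtension_adj_iff.2 (.inl (hadj k hk)))
    (fun k hk => ?_) h.mem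
  rw [isCollider_iff, isCollider_iff, maximalExtension_into_iff (hadj k (by omega)),
    maximalExtension_into_iff (hadj (k + 1) hk).symm]

theorem IsAncestral.markovEquiv_maximalExtension (hG : G.IsAncestral) :
    G.MarkovEquiv G.maximalExtension := by
  rw [markovEquiv_iff]
  intro C x y hxy
  constructor
  · rw [hG.isSimple.mConnected_iff, hG.maximalExtension.isSimple.mConnected_iff]
    rintro ⟨n, v, hstart, hend, h⟩
    exact ⟨n, v, hstart, hend, h.maximalExtension⟩
  · rw [hG.mConnected_iff_hasTrail hxy, hG.maximalExtension.mConnected_iff_hasTrail hxy]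
    exact And.imp_right fun ⟨a, h⟩ => ⟨a, h.of_maximalExtension hG⟩

/-! ### Separation of nonadjacent nodes -/

/-- The ancestors of `x` or `y` and the selection adjacent nodes, other than `x` and `y`. It
m-separates `x` and `y` unless they are joined by an inducing path. -/
def separator (G : LMG V) (x y : V) : Set V :=
  {u | u ≠ x ∧ u ≠ y ∧ (G.IsAncestor u x ∨ G.IsAncestor u y ∨ G.SelectionAdjacent u)}

theorem separator_comm (G : LMG V) (x y : V) : G.separator x y = G.separator y x := by
  ext u
  simp only [separator, Set.mem_ofPred_eq]
  tauto

theorem IsAncestral.isAncestor_of_mem_separator (hG : G.IsAncestral)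
    (hu : u ∈ G.separator x y ∪ G.ancestors (G.separator x y)) (htu : G.Into t u) :
    G.IsAncestor u x ∨ G.IsAncestor u y := by
  rcases hu with ⟨-, -, hx | hy | ⟨w, hw⟩⟩ | ⟨z, ⟨-, -, hx | hy | ⟨w, hw⟩⟩, huz⟩
  · exact .inl hx
  · exact .inr hy
  · exact (hG.not_und_of_into htu hw).elim
  · exact .inl (huz.trans hx)
  · exact .inr (huz.trans hy)
  · obtain ⟨p, -, hpz⟩ := Relation.TransGen.tail'_iff.1 huz
    exact (hG.not_und_of_into (.inl hpz) hw).elim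

theorem NodeConnecting.into_of_separator (hG : G.IsAncestral)
    (h : G.NodeConnecting (G.separator (v 0) (v n)) n v) (hk : k + 1 < n) :
    G.Into (v (k + 2)) (v (k + 1)) := by
  by_contra hinto
  have hnotMem : ¬ (G.IsAncestor (v (k + 1)) (v 0) ∨ G.IsAncestor (v (k + 1)) (v n) ∨
      G.SelectionAdjacent (v (k + 1))) := fun hmem =>
    h.notMem k hk (fun hcol => hinto hcol.2.2)
      ⟨h.isNodePath.ne hk.le (by omega) (by omega), h.isNodePath.ne hk.le le_rfl (by omega), hmem⟩
  push Not at hnotMem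
  obtain ⟨hstart, hend, hsel⟩ := hnotMem
  have hdir : G.dir (v (k + 1)) (v (k + 2)) := by
    rcases adj_iff.1 (h.isNodePath.adj (k + 1) hk) with hund | hbi | hdir | hdir
    · exact (hsel ⟨_, hund⟩).elim
    · exact (hinto (.inr (G.bi_symm hbi))).elim
    · exact hdir
    · exact (hinto (.inl hdir)).elim
  rcases hG.isAncestor_or_exists_collider h.isNodePath.adj hdir hk le_rfl with
    ⟨hanc, -⟩ | ⟨l, hkl, hln, hanc, hbefore, hafter⟩
  · exact hend hanc
  · obtain ⟨l, rfl⟩ : ∃ m, l = m + 1 := ⟨l - 1, by omega⟩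
    have hmem := h.mem l hln ((h.isNodePath.isCollider_iff hln).2 ⟨hbefore, hafter⟩)
    rcases hG.isAncestor_of_mem_separator hmem hbefore with hanc' | hanc'
    · exact hstart (hanc.trans hanc')
    · exact hend (hanc.trans hanc')

theorem NodeConnecting.isCollider_of_separator (hG : G.IsAncestral)
    (h : G.NodeConnecting (G.separator (v 0) (v n)) n v) (hk : k + 1 < n) :
    G.IsCollider (v k) (v (k + 1)) (v (k + 2)) := by
  have hreverse := h.reverse
  rw [separator_comm] at hreverse
  have hbefore := NodeConnecting.into_of_separator hG (v := fun k => v (n - k)) (n := n)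
    (by simpa using hreverse) (k := n - (k + 2)) (by omega)
  simp only [show n - (n - (k + 2) + 2) = k by omega,
    show n - (n - (k + 2) + 1) = k + 1 by omega] at hbefore
  exact (h.isNodePath.isCollider_iff hk).2 ⟨hbefore, h.into_of_separator hG hk⟩

theorem IsAncestral.not_mConnected_separator (hG : G.IsAncestral)
    (hind : ¬ G.InducingConnected x y) : ¬ G.MConnected (G.separator x y) x y := by
  rw [hG.isSimple.mConnected_iff]
  rintro ⟨n, v, rfl, rfl, h⟩
  have hcol := fun k (hk : k + 1 < n) => h.isCollider_of_separator hG hk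
  exact hind (hG.isSimple.inducingConnected_iff.2 ⟨n, v, ⟨h.isNodePath, hcol, fun k hk =>
    hG.isAncestor_of_mem_separator (h.mem k hk (hcol k hk)) (hcol k hk).2.1⟩, rfl, rfl⟩)

theorem NodeInducing.nodeConnecting_separator (h : G.NodeInducing n v) :
    G.NodeConnecting (G.separator (v 0) (v n)) n v where
  isNodePath := h.isNodePath
  mem k hk _ := .inl ⟨h.isNodePath.ne hk.le (by omega) (by omega),
    h.isNodePath.ne hk.le le_rfl (by omega), (h.isAncestor k hk).imp_right .inl⟩
  notMem k hk hcol := (hcol (h.isCollider k hk)).elim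
  start_notMem hmem := hmem.1 rfl
  end_notMem hmem := hmem.2.1 rfl

theorem IsAncestral.maximalExtension_isMaximal (hG : G.IsAncestral) :
    G.maximalExtension.IsMaximal := by
  intro i j hij hind
  by_contra hadj
  have hG' := hG.maximalExtension
  obtain ⟨n, v, hv, rfl, rfl⟩ := hG'.isSimple.inducingConnected_iff.1 hind
  have hsep := hG.not_mConnected_separator fun hind' =>
    hadj (maximalExtension_adj_iff.2 (.inr ⟨hij, hind'⟩))
  refine hsep ((markovEquiv_iff.1 hG.markovEquiv_maximalExtension _ _ _ hij).2 ?_)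
  exact hG'.isSimple.mConnected_iff.2 ⟨n, v, rfl, rfl, hv.nodeConnecting_separator⟩

end MaximalExtension

section Ordered

variable {V : Type*} {G H : LMG V} {C : Set V} {k m t : ℕ} {x y z c : V} {v : ℕ → V}

/-! ### Triples with order -/

/-- The triple `⟨x, y, z⟩` has some order. -/
def Ordered (G : LMG V) (x y z : V) : Prop :=
  ∃ t, G.TripleOfOrderLE t x y z

theorem TripleOfOrderLE.mono {s : ℕ} (h : G.TripleOfOrderLE s x y z) (hst : s ≤ t) :
    G.TripleOfOrderLE t x y z := by
  induction hst with
  | refl => exact h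
  | step _ ih => exact .inl ih

theorem TripleOfOrderLE.symm (h : G.TripleOfOrderLE t x y z) : G.TripleOfOrderLE t z y x := by
  induction t with
  | zero => exact ⟨⟨h.1.1.symm, h.1.2.2.symm, h.1.2.1.symm⟩, mt Adj.symm h.2⟩
  | succ t ih =>
    rcases h with h | ⟨m, v, e, hdisc, hle, hends⟩
    · exact .inl (ih h)
    · exact .inr ⟨m, v, e, hdisc, hle, hends.symm⟩

theorem Ordered.symm (h : G.Ordered x y z) : G.Ordered z y x :=
  h.imp fun _ => TripleOfOrderLE.symm

theorem mem_collidersWithOrder_iff :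
    (x, y, z) ∈ G.collidersWithOrder ↔ G.IsCollider x y z ∧ G.Ordered x y z := by
  classical
  refine and_congr_right fun _ => ⟨fun ⟨t, h⟩ => ⟨t, h.1⟩, fun h => ?_⟩
  exact ⟨Nat.find h, Nat.find_spec h, fun s hs => Nat.find_min h hs⟩

theorem nodeDiscriminating_of_not_adj (h : G.IsTriple x y z) (hadj : ¬ G.Adj x z) :
    G.NodeDiscriminating 0 (fun l => if l = 0 then x else y) z where
  isNodePath := by
    refine ⟨fun k hk => ?_, fun k hk l hl heq => ?_⟩
    · obtain rfl : k = 0 := by omega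
      exact h.2.1
    · have hxy := h.2.1.ne
      interval_cases k <;> interval_cases l <;> simp_all [eq_comm]
  start_ne := h.1
  adj_end := h.2.2
  not_adj := hadj
  isCollider k hk := by omega
  dir k hk := by omega

theorem NodeDiscriminating.ordered (hG : G.IsSimple) (h : G.NodeDiscriminating m v c)
    (hord : ∀ k < m, G.Ordered (v k) (v (k + 1)) (v (k + 2))) :
    G.Ordered (v m) (v (m + 1)) c := by
  choose! t ht using hord
  have hupdate : ∀ k ≤ m + 1, Function.update v (m + 2) c k = v k := fun k hk =>
    Function.update_of_ne (by omega) _ _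
  have hdisc : G.NodeDiscriminating m (Function.update v (m + 2) c)
      (Function.update v (m + 2) c (m + 2)) := by
    rw [Function.update_self]
    exact h.congr hupdate
  obtain ⟨e, he⟩ := hG.exists_isDiscriminatingPath_iff.2 hdisc
  refine ⟨(Finset.range m).sup t + 1, .inr ⟨m, _, e, he, fun k hk => ?_, .inl ?_⟩⟩
  · rw [hupdate k (by omega), hupdate (k + 1) (by omega), hupdate (k + 2) (by omega)]
    exact (ht k hk).mono (Finset.le_sup (Finset.mem_range.2 hk))
  · rw [hupdate m (by omega), hupdate (m + 1) le_rfl, Function.update_self]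
    exact ⟨rfl, rfl, rfl⟩

/-- Unshielded triples are the case `m = 0` of `disc`. -/
theorem Ordered.induction (hG : G.IsSimple) {P : V → V → V → Prop} (h : G.Ordered x y z)
    (disc : ∀ ⦃m v c⦄, G.NodeDiscriminating m v c →
      (∀ k < m, G.Ordered (v k) (v (k + 1)) (v (k + 2)) ∧ P (v k) (v (k + 1)) (v (k + 2))) →
      P (v m) (v (m + 1)) c)
    (symm : ∀ ⦃x y z⦄, P x y z → P z y x) : P x y z := by
  obtain ⟨t, h⟩ := h
  induction t generalizing x y z with
  | zero => exact disc (nodeDiscriminating_of_not_adj h.1 h.2) (by omega)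
  | succ t ih =>
    rcases h with h | ⟨m, v, e, hdisc, hle, hends⟩
    · exact ih h
    · have hP := disc (hG.exists_isDiscriminatingPath_iff.1 ⟨e, hdisc⟩)
        fun k hk => ⟨⟨t, hle k hk⟩, ih (hle k hk)⟩
      rcases hends with ⟨rfl, rfl, rfl⟩ | ⟨rfl, rfl, rfl⟩
      · exact hP
      · exact symm hP

/-- The graphs have the same adjacencies, and on common discriminating paths whose triples have
order, the discriminated triple is a collider either in both graphs or in none. -/
structure AgreeOnDiscriminated (G H : LMG V) : Prop where
  adj_iff : ∀ x y, G.Adj x y ↔ H.Adj x y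
  isCollider_iff : ∀ ⦃m v c⦄, G.NodeDiscriminating m v c → H.NodeDiscriminating m v c →
    (∀ k < m, G.Ordered (v k) (v (k + 1)) (v (k + 2))) →
    (∀ k < m, H.Ordered (v k) (v (k + 1)) (v (k + 2))) →
    (G.IsCollider (v m) (v (m + 1)) c ↔ H.IsCollider (v m) (v (m + 1)) c)

namespace AgreeOnDiscriminated

theorem symm (h : G.AgreeOnDiscriminated H) : H.AgreeOnDiscriminated G where
  adj_iff x y := (h.adj_iff x y).symm
  isCollider_iff _ _ _ hH hG hordH hordG := (h.isCollider_iff hG hH hordG hordH).symm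

theorem isNodePath (h : G.AgreeOnDiscriminated H) (hv : G.IsNodePath m v) : H.IsNodePath m v :=
  ⟨fun k hk => (h.adj_iff _ _).1 (hv.adj k hk), hv.inj⟩

theorem dir_of_dir (h : G.AgreeOnDiscriminated H) (hG : G.IsAncestral) (hH : H.IsAncestral)
    (hv : G.IsNodePath (m + 1) v) (hne : v 0 ≠ c) (hadj : ¬ G.Adj (v 0) c)
    (hcolG : ∀ k < m, G.IsCollider (v k) (v (k + 1)) (v (k + 2)))
    (hcolH : ∀ k < m, H.IsCollider (v k) (v (k + 1)) (v (k + 2)))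
    (hordG : ∀ k < m, G.Ordered (v k) (v (k + 1)) (v (k + 2)))
    (hordH : ∀ k < m, H.Ordered (v k) (v (k + 1)) (v (k + 2)))
    (hdir : ∀ k < m, G.dir (v (k + 1)) c) : ∀ k < m, H.dir (v (k + 1)) c := by
  intro k hk
  induction k using Nat.strong_induction_on with
  | _ k ih =>
    have hvk : G.IsNodePath (k + 1) v := by simpa using hv.segment (j := 0) (by omega)
    have hkc := adj_of_dir (hdir k hk)
    have hdiscG : G.NodeDiscriminating k v c := ⟨hvk, hne, hkc, hadj,
      fun l hl => hcolG l (by omega), fun l hl => hdir l (by omega)⟩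
    have hdiscH : H.NodeDiscriminating k v c := ⟨h.isNodePath hvk, hne, (h.adj_iff _ _).1 hkc,
      mt (h.adj_iff _ _).2 hadj, fun l hl => hcolH l (by omega), fun l hl => ih l hl (by omega)⟩
    have hiff := h.isCollider_iff hdiscG hdiscH (fun l hl => hordG l (by omega))
      fun l hl => hordH l (by omega)
    refine hH.dir_of_not_into (hcolH k hk).2.1 hdiscH.adj_end fun hinto => ?_
    exact hG.not_into_of_dir (hdir k hk)
      (hiff.2 ⟨hdiscG.ne_end (by omega), (hcolH k hk).2.1, hinto⟩).2.2

theorem nodeDiscriminating (h : G.AgreeOnDiscriminated H) (hG : G.IsAncestral)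
    (hH : H.IsAncestral) (hv : G.NodeDiscriminating m v c)
    (hordG : ∀ k < m, G.Ordered (v k) (v (k + 1)) (v (k + 2)))
    (hordH : ∀ k < m, H.Ordered (v k) (v (k + 1)) (v (k + 2)))
    (hcolH : ∀ k < m, H.IsCollider (v k) (v (k + 1)) (v (k + 2))) :
    H.NodeDiscriminating m v c where
  isNodePath := h.isNodePath hv.isNodePath
  start_ne := hv.start_ne
  adj_end := (h.adj_iff _ _).1 hv.adj_end
  not_adj := mt (h.adj_iff _ _).2 hv.not_adj
  isCollider := hcolH
  dir := h.dir_of_dir hG hH hv.isNodePath hv.start_ne hv.not_adj hv.isCollider hcolH hordG hordH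
    hv.dir

theorem ordered_and_isCollider_iff (h : G.AgreeOnDiscriminated H) (hG : G.IsAncestral)
    (hH : H.IsAncestral) (hord : G.Ordered x y z) :
    H.Ordered x y z ∧ (G.IsCollider x y z ↔ H.IsCollider x y z) := by
  refine hord.induction hG.isSimple
    (P := fun x y z => H.Ordered x y z ∧ (G.IsCollider x y z ↔ H.IsCollider x y z))
    (fun m v c hv hlt => ?_) fun x y z ⟨hordH, hiff⟩ =>
      ⟨hordH.symm, fun hcol => (hiff.1 hcol.symm).symm, fun hcol => (hiff.2 hcol.symm).symm⟩
  have hordG := fun k hk => (hlt k hk).1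
  have hordH := fun k hk => (hlt k hk).2.1
  have hvH := h.nodeDiscriminating hG hH hv hordG hordH
    fun k hk => (hlt k hk).2.2.1 (hv.isCollider k hk)
  exact ⟨hvH.ordered hH.isSimple hordH, h.isCollider_iff hv hvH hordG hordH⟩

theorem collidersWithOrder_subset (h : G.AgreeOnDiscriminated H) (hG : G.IsAncestral)
    (hH : H.IsAncestral) : G.collidersWithOrder ⊆ H.collidersWithOrder := by
  rintro ⟨x, y, z⟩ hxyz
  obtain ⟨hcol, hord⟩ := mem_collidersWithOrder_iff.1 hxyz
  obtain ⟨hordH, hiff⟩ := h.ordered_and_isCollider_iff hG hH hord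
  exact mem_collidersWithOrder_iff.2 ⟨hiff.1 hcol, hordH⟩

theorem collidersWithOrder_eq (h : G.AgreeOnDiscriminated H) (hG : G.IsAncestral)
    (hH : H.IsAncestral) : G.collidersWithOrder = H.collidersWithOrder :=
  (h.collidersWithOrder_subset hG hH).antisymm (h.symm.collidersWithOrder_subset hH hG)

end AgreeOnDiscriminated

theorem agreeOnDiscriminated_of_collidersWithOrder_eq (hG : G.IsSimple) (hH : H.IsSimple)
    (hadj : ∀ x y, G.Adj x y ↔ H.Adj x y) (h : G.collidersWithOrder = H.collidersWithOrder) :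
    G.AgreeOnDiscriminated H where
  adj_iff := hadj
  isCollider_iff m v c hvG hvH hordG hordH := by
    have hmem : (v m, v (m + 1), c) ∈ G.collidersWithOrder ↔
        (v m, v (m + 1), c) ∈ H.collidersWithOrder := by rw [h]
    simpa only [mem_collidersWithOrder_iff, hvG.ordered hG hordG, hvH.ordered hH hordH,
      and_true] using hmem

/-! ### Markov equivalent maximal ancestral graphs have the same colliders with order -/

namespace NodeDiscriminating

theorem hasTrail (hG : G.IsAncestral) (h : G.NodeDiscriminating m v c) (hstart : v 0 ∉ C)
    (hend : c ∉ C) (hsep : ¬ G.MConnected C (v 0) c) (hk : k ≤ m) :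
    G.HasTrail C (v 0) (v (k + 1)) (G.Into (v k) (v (k + 1))) := by
  rw [hG.mConnected_iff_hasTrail h.start_ne] at hsep
  induction k with
  | zero =>
    exact (HasTrail.nil G C (v 0)).step (h.isNodePath.adj 0 (by omega))
      (canPass_of_notMem And.left hstart)
  | succ k ih =>
    have htrail := ih (by omega)
    have hmem : v (k + 1) ∈ C := by
      by_contra hmem
      have := htrail.step (adj_of_dir (h.dir k hk))
        (canPass_of_notMem (fun h' => hG.not_into_of_dir (h.dir k hk) h'.2) hmem)
      exact hsep ⟨hend, _, this⟩
    exact htrail.step (h.isNodePath.adj (k + 1) (by omega))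
      (canPass_of_reachesIn (h.isCollider k hk).2.1 (h.isCollider k hk).2.2
        (k := 0) hmem)

theorem isCollider_iff_notMem (hG : G.IsAncestral) (h : G.NodeDiscriminating m v c)
    (hstart : v 0 ∉ C) (hend : c ∉ C) (hsep : ¬ G.MConnected C (v 0) c) :
    G.IsCollider (v m) (v (m + 1)) c ↔ v (m + 1) ∉ C := by
  have htrail := h.hasTrail hG hstart hend hsep le_rfl
  rw [hG.mConnected_iff_hasTrail h.start_ne] at hsep
  have hpass : ∀ k, ¬ G.CanPass C (v (m + 1)) (G.Into (v m) (v (m + 1))) (G.Into c (v (m + 1))) k :=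
    fun k hk => hsep ⟨hend, _, htrail.step h.adj_end hk⟩
  constructor
  · exact fun hcol hmem => hpass 0 (canPass_of_reachesIn hcol.2.1 hcol.2.2 hmem)
  · intro hmem
    by_contra hcol
    exact hpass 0 (canPass_of_notMem (fun h' => hcol ⟨h.ne_end (by omega), h'⟩) hmem)

end NodeDiscriminating

theorem IsAncestral.mConnected_of_adj (hG : G.IsAncestral) (h : G.Adj x y) (hx : x ∉ C)
    (hy : y ∉ C) : G.MConnected C x y :=
  (hG.mConnected_iff_hasTrail h.ne).2
    ⟨hy, _, (HasTrail.nil G C x).step h (canPass_of_notMem And.left hx)⟩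

namespace MarkovEquiv

theorem adj_of_adj (h : G.MarkovEquiv H) (hG : G.IsAncestral) (hH : H.IsAncestral)
    (hmax : G.IsMaximal) (hxy : H.Adj x y) : G.Adj x y := by
  refine hmax x y hxy.ne (by_contra fun hind => hG.not_mConnected_separator hind ?_)
  exact (markovEquiv_iff.1 h _ _ _ hxy.ne).2
    (hH.mConnected_of_adj hxy (fun hx => hx.1 rfl) fun hy => hy.2.1 rfl)

theorem agreeOnDiscriminated (h : G.MarkovEquiv H) (hG : G.IsAncestral) (hH : H.IsAncestral)
    (hmaxG : G.IsMaximal) (hmaxH : H.IsMaximal) : G.AgreeOnDiscriminated H where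
  adj_iff x y := ⟨adj_of_adj h.symm hH hG hmaxH, h.adj_of_adj hG hH hmaxG⟩
  isCollider_iff m v c hvG hvH _ _ := by
    have hsep := hG.not_mConnected_separator fun hind => hvG.not_adj (hmaxG _ _ hvG.start_ne hind)
    have hstart : v 0 ∉ G.separator (v 0) c := fun hmem => hmem.1 rfl
    have hend : c ∉ G.separator (v 0) c := fun hmem => hmem.2.1 rfl
    rw [hvG.isCollider_iff_notMem hG hstart hend hsep,
      hvH.isCollider_iff_notMem hH hstart hend
        (mt (markovEquiv_iff.1 h _ _ _ hvG.start_ne).2 hsep)]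

end MarkovEquiv

end Ordered

section MinimalWalks

variable {V : Type*} {G : LMG V} {C : Set V} {i j m n p r t : ℕ} {c : V} {v : ℕ → V} {w : ℕ → ℕ}

/-! ### Triples on minimal connecting walks -/

/-- The node `v k` is a collider on the walk `v 0, …, v n`. -/
def IsColliderOn (G : LMG V) (n : ℕ) (v : ℕ → V) (k : ℕ) : Prop :=
  G.ArrowBefore v k ∧ G.ArrowAfter n v k

theorem isColliderOn_reverse {k : ℕ} (hk : k ≤ n) :
    G.IsColliderOn n (fun l => v (n - l)) k ↔ G.IsColliderOn n v (n - k) := by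
  rw [IsColliderOn, arrowBefore_reverse hk, arrowAfter_reverse hk, IsColliderOn, and_comm]

theorem IsNodePath.isCollider_iff_isColliderOn (h : G.IsNodePath n v) {k : ℕ} (hk : k + 1 < n) :
    G.IsCollider (v k) (v (k + 1)) (v (k + 2)) ↔ G.IsColliderOn n v (k + 1) := by
  rw [h.isCollider_iff hk, IsColliderOn, arrowBefore_succ, arrowAfter_of_lt hk]

/-- If the inner nodes of the walk between `v j` and `v i` are followed by `c` instead of the rest
of the walk, they form a discriminating path for `v i`, apart from the edge between `v i` and `c`.
Here `j` may lie on either side of `i`, as discriminating paths occur in both directions. -/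
structure IsDiscriminatingSegment (G : LMG V) (n : ℕ) (v : ℕ → V) (j i : ℕ) (c : V) : Prop where
  not_adj : ¬ G.Adj (v j) c
  isColliderOn : ∀ k ∈ Set.uIoo j i, G.IsColliderOn n v k
  dir : ∀ k ∈ Set.uIoo j i, G.dir (v k) c

theorem isDiscriminatingSegment_reverse (hj : j ≤ n) (hi : i ≤ n) :
    G.IsDiscriminatingSegment n (fun l => v (n - l)) j i c ↔
      G.IsDiscriminatingSegment n v (n - j) (n - i) c := by
  have hmem : ∀ k ≤ n, n - k ∈ Set.uIoo (n - j) (n - i) ↔ k ∈ Set.uIoo j i := by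
    intro k hk
    simp only [Set.uIoo_eq_union, Set.mem_union, Set.mem_Ioo]
    omega
  have hle : ∀ k, k ∈ Set.uIoo j i ∨ k ∈ Set.uIoo (n - j) (n - i) → k ≤ n := by
    intro k
    simp only [Set.uIoo_eq_union, Set.mem_union, Set.mem_Ioo]
    omega
  constructor
  · rintro ⟨hnadj, hcol, hdir⟩
    refine ⟨hnadj, fun k hk => ?_, fun k hk => ?_⟩ <;>
      have hkn := hle k (.inr hk) <;>
      obtain ⟨l, hl, rfl⟩ : ∃ l ≤ n, k = n - l := ⟨n - k, by omega, by omega⟩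
    · exact (isColliderOn_reverse hl).1 (hcol l ((hmem l hl).1 hk))
    · exact hdir l ((hmem l hl).1 hk)
  · rintro ⟨hnadj, hcol, hdir⟩
    refine ⟨hnadj, fun k hk => ?_, fun k hk => ?_⟩ <;> have hkn := hle k (.inl hk)
    · exact (isColliderOn_reverse hkn).2 (hcol _ ((hmem k hkn).2 hk))
    · exact hdir _ ((hmem k hkn).2 hk)

namespace IsDiscriminatingSegment

theorem nodeDiscriminating (hv : G.IsNodePath n v) (hn : j + m + 1 ≤ n)
    (h : G.IsDiscriminatingSegment n v j (j + m + 1) c) (hne : v j ≠ c)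
    (hadj : G.Adj (v (j + m + 1)) c) : G.NodeDiscriminating m (fun l => v (j + l)) c where
  isNodePath := hv.segment hn
  start_ne := hne
  adj_end := hadj
  not_adj := h.not_adj
  isCollider k hk := (hv.isCollider_iff_isColliderOn (k := j + k) (by omega)).2
    (h.isColliderOn _ (Set.mem_uIoo_of_lt (by omega) (by omega)))
  dir k hk := h.dir _ (Set.mem_uIoo_of_lt (by omega) (by omega))

theorem ordered_of_le (hG : G.IsSimple) (hv : G.IsNodePath n v) (hi : i + 2 ≤ n) (hj : j ≤ i)
    (h : G.IsDiscriminatingSegment n v j (i + 1) (v (i + 2)))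
    (hord : ∀ k, j ≤ k → k < i → G.Ordered (v k) (v (k + 1)) (v (k + 2))) :
    G.Ordered (v i) (v (i + 1)) (v (i + 2)) := by
  obtain ⟨m, rfl⟩ := Nat.exists_eq_add_of_le hj
  exact (h.nodeDiscriminating hv (by omega) (hv.ne (by omega) hi (by omega))
    (hv.adj _ (by omega))).ordered (v := fun l => v (j + l)) hG
    fun k hk => hord (j + k) (by omega) (by omega)

theorem ordered_of_gt (hG : G.IsSimple) (hv : G.IsNodePath n v) (hr : r < n) (hi : i < r)
    (h : G.IsDiscriminatingSegment n v (r + 1) (i + 1) (v i))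
    (hord : ∀ k, i < k → k < r → G.Ordered (v k) (v (k + 1)) (v (k + 2))) :
    G.Ordered (v i) (v (i + 1)) (v (i + 2)) := by
  obtain ⟨l, rfl⟩ : ∃ l, n = l + 2 + i := ⟨n - (i + 2), by omega⟩
  have hsub : ∀ a b, l + 2 + i = a + b → l + 2 + i - a = b := by omega
  have hrev := (isDiscriminatingSegment_reverse (by omega) (by omega)).2
    (show G.IsDiscriminatingSegment (l + 2 + i) v (l + 2 + i - (l + 1 + i - r))
      (l + 2 + i - (l + 1)) (v (l + 2 + i - (l + 2))) by
        rwa [hsub _ (r + 1) (by omega), hsub _ (i + 1) (by omega), hsub _ i rfl])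
  have hord' := hrev.ordered_of_le hG hv.reverse (by omega) (by omega) fun k hjk hkl => by
    have := (hord (i + l - k) (by omega) (by omega)).symm
    rwa [hsub k (i + l - k + 2) (by omega), hsub (k + 1) (i + l - k + 1) (by omega),
      hsub (k + 2) (i + l - k) (by omega)]
  rw [hsub l (i + 2) (by omega), hsub (l + 1) (i + 1) (by omega), hsub _ i rfl] at hord'
  exact hord'.symm

end IsDiscriminatingSegment

theorem exists_last_not {P : ℕ → Prop} (h0 : ¬ P 0) (hi : 0 < i) :
    ∃ j < i, ¬ P j ∧ ∀ k, j < k → k < i → P k := by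
  classical
  refine ⟨Nat.findGreatest (fun k => ¬ P k) (i - 1), ?_,
    Nat.findGreatest_spec (P := fun k => ¬ P k) (Nat.zero_le _) h0,
    fun k hk hki => not_not.1 (Nat.findGreatest_is_greatest hk (by omega))⟩
  have := Nat.findGreatest_le (P := fun k => ¬ P k) (i - 1)
  omega

namespace IsConnectingWalk

theorem canPass_redirect (hG : G.IsAncestral) (h : G.IsConnectingWalk C n v w) (hj : j ≤ n)
    (hadj : G.Adj (v j) c) (hdir : G.IsColliderOn n v j → ¬ G.dir (v j) c)
    (harrow : G.ArrowBefore v j → G.Into c (v j) → G.ArrowAfter n v j) :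
    G.CanPass C (v j) (G.ArrowBefore v j) (G.Into c (v j)) (w j) := by
  by_cases hcol : G.IsColliderOn n v j
  · have hinto : G.Into c (v j) :=
      by_contra fun hinto => hdir hcol (hG.dir_of_not_into hcol.1.2 hadj hinto)
    exact canPass_of_reachesIn hcol.1 hinto ((h.canPass j hj).reachesIn hcol.1 hcol.2)
  · exact (h.canPass j hj).congr_of_not hcol fun h' => hcol ⟨h'.1, harrow h'.1 h'.2⟩

/-- Walk back from `v i` as long as the nodes are colliders and parents of `c`. At the first node
`v j` that is not, the walk can be redirected to `c` unless `v j` and `c` are nonadjacent. -/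
theorem exists_isDiscriminatingSegment_or_trail (hG : G.IsAncestral)
    (h : G.IsConnectingWalk C n v w) (hi : i ≤ n) (harrow : G.ArrowBefore v i)
    (hdir : G.dir (v i) c) :
    (∃ j < i, G.IsDiscriminatingSegment n v j i c) ∨
      ∃ j < i, G.Into (v j) c ∧
        G.Trail C (v 0) (j + 1) (∑ l ∈ Finset.range (j + 1), w l) c (G.Into (v j) c) := by
  obtain ⟨j, hj, hnot, hlast⟩ := exists_last_not
    (P := fun k => G.IsColliderOn n v k ∧ G.dir (v k) c) (fun h0 => h0.1.1.1.false) harrow.1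
  by_cases hadj : G.Adj (v j) c
  · have hnext : G.Into (v j) (v (j + 1)) ∧ G.dir (v (j + 1)) c := by
      rcases (show j + 1 ≤ i by omega).lt_or_eq with hji | rfl
      · exact (hlast _ (by omega) hji).imp_left fun hcol => hcol.1.2
      · exact ⟨harrow.2, hdir⟩
    have hpass := h.canPass_redirect hG (by omega) hadj (fun hcol hjc => hnot ⟨hcol, hjc⟩)
      fun hbefore hinto => by_contra fun hafter => by
        have hstep : G.dir (v j) (v (j + 1)) :=
          hG.dir_of_not_into hbefore.2 hnext.1.adj fun hback => hafter ⟨by omega, hback⟩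
        exact hG.not_isAncestor_of_into hinto
          (.trans (isAncestor_of_dir hstep) (isAncestor_of_dir hnext.2))
    refine .inr ⟨j, hj, hG.into_of_into_of_dir hnext.1 hnext.2 hadj, ?_⟩
    rw [Finset.sum_range_succ]
    exact .step (h.trail (by omega)) hadj hpass
  · have hseg : ∀ k ∈ Set.uIoo j i, G.IsColliderOn n v k ∧ G.dir (v k) c := by
      rw [Set.uIoo_of_lt hj]
      exact fun k hk => hlast k hk.1 hk.2
    exact .inl ⟨j, hj, hadj, fun k hk => (hseg k hk).1, fun k hk => (hseg k hk).2⟩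

theorem exists_canPass_shortcut (hG : G.IsAncestral) (h : G.IsConnectingWalk C n v w)
    (hj : j + 2 ≤ n) (hadj : G.Adj (v j) (v (j + 2)))
    (hdir : G.IsColliderOn n v j → ¬ G.dir (v j) (v (j + 2))) :
    ∃ k, G.CanPass C (v j) (G.ArrowBefore v j) (G.Into (v (j + 2)) (v j)) k := by
  by_cases harrow : G.ArrowBefore v j → G.Into (v (j + 2)) (v j) → G.ArrowAfter n v j
  · exact ⟨_, h.canPass_redirect hG (by omega) hadj hdir harrow⟩
  push Not at harrow
  obtain ⟨hbefore, hinto, hafter⟩ := harrow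
  have hstep : G.dir (v j) (v (j + 1)) :=
    hG.dir_of_not_into hbefore.2 (h.adj j (by omega)) fun hback => hafter ⟨by omega, hback⟩
  have hback : G.Into (v (j + 2)) (v (j + 1)) := by
    by_contra hback
    have hstep' := hG.dir_of_not_into (.inl hstep) (h.adj (j + 1) (by omega)) hback
    exact hG.not_isAncestor_of_into hinto
      (.trans (isAncestor_of_dir hstep) (isAncestor_of_dir hstep'))
  have hreach := (h.canPass (j + 1) (by omega)).reachesIn ⟨by omega, .inl hstep⟩ ⟨by omega, hback⟩
  exact ⟨w (j + 1) + 1, canPass_of_reachesIn hbefore hinto ⟨v (j + 1), hstep, hreach⟩⟩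

end IsConnectingWalk

namespace IsMinimalWalk

theorem isColliderOn_and_dir_of_adj (hG : G.IsAncestral) (h : G.IsMinimalWalk C n v w)
    (hj : j + 2 ≤ n) (hadj : G.Adj (v j) (v (j + 2))) :
    (G.IsColliderOn n v j ∧ G.dir (v j) (v (j + 2))) ∨
      (G.IsColliderOn n v (j + 2) ∧ G.dir (v (j + 2)) (v j)) := by
  by_contra hnot
  simp only [not_or, not_and] at hnot
  obtain ⟨k, hk⟩ := h.exists_canPass_shortcut hG hj hadj hnot.1
  obtain ⟨m, rfl⟩ := Nat.exists_eq_add_of_le' hj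
  have hm : m + (j + 2) - m = j + 2 := by omega
  have hm' : m + (j + 2) - (m + 2) = j := by omega
  obtain ⟨l, hl⟩ := h.toIsConnectingWalk.reverse.exists_canPass_shortcut hG (j := m) (by omega)
    (by simpa only [hm, hm'] using hadj.symm)
    (by simpa only [isColliderOn_reverse (Nat.le_add_right m _), hm, hm'] using hnot.2)
  rw [arrowBefore_reverse (by omega)] at hl
  simp only [hm, hm'] at hl
  have := h.length_le (.step (h.toIsConnectingWalk.trail (by omega)) hadj hk)
    (h.toIsConnectingWalk.trail_reverse hj) hl.symm
  omega

theorem exists_isDiscriminatingSegment_of_dir (hG : G.IsAncestral) (h : G.IsMinimalWalk C n v w)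
    (hj : j + 2 ≤ n) (hcol : G.IsColliderOn n v j) (hdir : G.dir (v j) (v (j + 2))) :
    ∃ l < j, G.IsDiscriminatingSegment n v l (j + 1) (v (j + 2)) := by
  rcases h.exists_isDiscriminatingSegment_or_trail hG (by omega) hcol.1 hdir with
    ⟨l, hl, hseg⟩ | ⟨l, hl, hinto, htrail⟩
  · refine ⟨l, hl, hseg.not_adj, fun k hk => ?_, fun k hk => ?_⟩ <;>
      rw [Set.uIoo_of_lt (by omega), Set.mem_Ioo, Nat.lt_succ_iff_lt_or_eq] at hk <;>
      obtain ⟨hlk, hkj | rfl⟩ := hk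
    · exact hseg.isColliderOn k (Set.mem_uIoo_of_lt hlk hkj)
    · exact hcol
    · exact hseg.dir k (Set.mem_uIoo_of_lt hlk hkj)
    · exact hdir
  · have hbefore : G.Into (v (j + 1)) (v (j + 2)) :=
      hG.into_of_into_of_dir hcol.2.2 hdir (h.adj (j + 1) (by omega))
    have hpass := h.canPass (j + 2) hj
    rw [arrowBefore_succ, eq_true hbefore, ← eq_true hinto] at hpass
    have := h.length_le htrail (h.toIsConnectingWalk.trail_reverse hj) hpass
    omega

theorem exists_isDiscriminatingSegment (hG : G.IsAncestral) (h : G.IsMinimalWalk C n v w)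
    (hi : i + 2 ≤ n) :
    (∃ j ≤ i, G.IsDiscriminatingSegment n v j (i + 1) (v (i + 2))) ∨
      ∃ r, i < r ∧ r < n ∧ G.IsDiscriminatingSegment n v (r + 1) (i + 1) (v i) := by
  by_cases hadj : G.Adj (v i) (v (i + 2))
  · rcases h.isColliderOn_and_dir_of_adj hG hi hadj with ⟨hcol, hdir⟩ | ⟨hcol, hdir⟩
    · exact .inl ((h.exists_isDiscriminatingSegment_of_dir hG hi hcol hdir).imp
        fun j hj => ⟨hj.1.le, hj.2⟩)
    · obtain ⟨m, rfl⟩ := Nat.exists_eq_add_of_le' hi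
      have hm : m + (i + 2) - m = i + 2 := by omega
      have hm' : m + (i + 2) - (m + 2) = i := by omega
      obtain ⟨l, hl, hseg⟩ := h.reverse.exists_isDiscriminatingSegment_of_dir hG (j := m)
        (by omega) ((isColliderOn_reverse (by omega)).2 (by rwa [hm])) (by rwa [hm, hm'])
      rw [isDiscriminatingSegment_reverse (by omega) (by omega), hm',
        show m + (i + 2) - (m + 1) = i + 1 by omega,
        show m + (i + 2) - l = m + i + 1 - l + 1 by omega] at hseg
      exact .inr ⟨m + i + 1 - l, by omega, by omega, hseg⟩
  · refine .inl ⟨i, le_rfl, hadj, fun k hk => ?_, fun k hk => ?_⟩ <;>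
      rw [Set.uIoo_of_lt (by omega), Set.mem_Ioo] at hk <;> omega

end IsMinimalWalk

/-- Two discriminating paths in opposite directions that overlap without one being inside the other
would make up an inducing path between nonadjacent nodes. -/
theorem IsDiscriminatingSegment.nested (hG : G.IsAncestral) (hmax : G.IsMaximal)
    (hv : G.IsNodePath n v) (hr : r < n)
    (hleft : G.IsDiscriminatingSegment n v j (t + 1) (v (t + 2)))
    (hright : G.IsDiscriminatingSegment n v (r + 1) (p + 1) (v p)) (hpt : p < t) (htr : t < r) :
    p < j := by
  by_contra! hjp
  have hcolL : ∀ k, j < k → k < t + 1 → G.IsColliderOn n v k :=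
    fun k hjk hkt => hleft.isColliderOn k (Set.mem_uIoo_of_lt hjk hkt)
  have hdirL : ∀ k, j < k → k < t + 1 → G.dir (v k) (v (t + 2)) :=
    fun k hjk hkt => hleft.dir k (Set.mem_uIoo_of_lt hjk hkt)
  have hcolR : ∀ k, p + 1 < k → k < r + 1 → G.IsColliderOn n v k :=
    fun k hpk hkr => hright.isColliderOn k (Set.mem_uIoo_of_gt hpk hkr)
  have hdirR : ∀ k, p + 1 < k → k < r + 1 → G.dir (v k) (v p) :=
    fun k hpk hkr => hright.dir k (Set.mem_uIoo_of_gt hpk hkr)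
  obtain rfl : j = p := by
    by_contra hne
    exact hG.not_isAncestor_of_into (hcolR (t + 1) (by omega) (by omega)).2.2
      (.trans (isAncestor_of_dir (hdirR (t + 1) (by omega) (by omega)))
        (isAncestor_of_dir (hdirL p (by omega) (by omega))))
  obtain rfl : r = t + 1 := by
    by_contra hne
    exact hG.not_isAncestor_of_into (hcolL (j + 1) (by omega) (by omega)).1.2
      (.trans (isAncestor_of_dir (hdirL (j + 1) (by omega) (by omega)))
        (isAncestor_of_dir (hdirR (t + 2) (by omega) (by omega))))
  obtain ⟨l, rfl⟩ := Nat.exists_eq_add_of_le hpt.le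
  have hind : G.NodeInducing (l + 2) (fun k => v (j + k)) := by
    refine ⟨hv.segment (by omega), fun k hk => ?_, fun k hk => ?_⟩ <;>
      rcases (show k ≤ l by omega).lt_or_eq with hkl | rfl
    · exact (hv.isCollider_iff_isColliderOn (k := j + k) (by omega)).2
        (hcolL _ (by omega) (by omega))
    · exact (hv.isCollider_iff_isColliderOn (k := j + k) (by omega)).2
        (hcolR _ (by omega) (by omega))
    · exact .inr (isAncestor_of_dir (hdirL _ (by omega) (by omega)))
    · exact .inl (isAncestor_of_dir (hdirR _ (by omega) (by omega)))
  exact hright.not_adj (hmax _ _ (hv.ne (by omega) hr (by omega))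
    (hG.isSimple.inducingConnected_iff.2 ⟨_, _, hind, rfl, rfl⟩)).symm

theorem forall_lt_of_nested {P : ℕ → Prop} {L R : ℕ → ℕ → Prop} {N : ℕ}
    (hLR : ∀ i < N, (∃ j, L i j) ∨ ∃ r, R i r)
    (hL : ∀ i j, L i j → (∀ l, j ≤ l → l < i → P l) → P i)
    (hR : ∀ i r, R i r → (∀ l, i < l → l < r → P l) → P i)
    (hRN : ∀ i r, R i r → r ≤ N)
    (hnested : ∀ i r t j, R i r → i < t → t < r → L t j → i < j) : ∀ i < N, P i := by
  have hright : ∀ i r, R i r → P i := by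
    intro i r hir
    induction hk : N - i using Nat.strong_induction_on generalizing i r with
    | _ k ih =>
      refine hR i r hir fun t => ?_
      induction t using Nat.strong_induction_on with
      | _ t ih' =>
        intro hit htr
        have hrN := hRN i r hir
        rcases hLR t (by omega) with ⟨j, hj⟩ | ⟨r', hr'⟩
        · have hij := hnested i r t j hir hit htr hj
          exact hL t j hj fun l hjl hlt => ih' l hlt (by omega) (by omega)
        · exact ih (N - t) (by omega) t r' hr' rfl
  intro i
  induction i using Nat.strong_induction_on with
  | _ i ih =>
    intro hi
    rcases hLR i hi with ⟨j, hj⟩ | ⟨r, hr⟩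
    · exact hL i j hj fun l _ hli => ih l hli (by omega)
    · exact hright i r hr

theorem IsMinimalWalk.ordered (hG : G.IsAncestral) (hmax : G.IsMaximal)
    (h : G.IsMinimalWalk C n v w) :
    ∀ i < n - 1, G.Ordered (v i) (v (i + 1)) (v (i + 2)) := by
  have hv := h.isNodePath hG
  refine forall_lt_of_nested
    (L := fun i j => i + 2 ≤ n ∧ j ≤ i ∧ G.IsDiscriminatingSegment n v j (i + 1) (v (i + 2)))
    (R := fun i r => i < r ∧ r < n ∧ G.IsDiscriminatingSegment n v (r + 1) (i + 1) (v i))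
    (fun i hi => ?_) ?_ ?_ (fun i r hr => by omega) ?_
  · have hin : i + 2 ≤ n := by omega
    simpa only [hin, true_and] using h.exists_isDiscriminatingSegment hG hin
  · rintro i j ⟨hi, hj, hseg⟩
    exact hseg.ordered_of_le hG.isSimple hv hi hj
  · rintro i r ⟨hi, hr, hseg⟩
    exact hseg.ordered_of_gt hG.isSimple hv hr hi
  · rintro i r t j ⟨-, hr, hright⟩ hit htr ⟨-, -, hleft⟩
    exact hleft.nested hG hmax hv hr hright hit htr

end MinimalWalks

section Transfer

variable {V : Type*} {G H : LMG V} {C : Set V} {i j k n : ℕ} {x y u d : V} {v : ℕ → V} {w : ℕ → ℕ}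

/-! ### Markov equivalence of maximal ancestral graphs -/

theorem sum_range_split (w : ℕ → ℕ) (hi : i ≤ n) :
    ∑ l ∈ Finset.range (n + 1), w l =
      ∑ l ∈ Finset.range i, w l + w i + ∑ l ∈ Finset.range (n - i), w (n - l) := by
  obtain ⟨m, rfl⟩ := Nat.exists_eq_add_of_le hi
  rw [Nat.add_right_comm, Finset.sum_range_add, Finset.sum_range_succ, Nat.add_sub_cancel_left,
    ← Finset.sum_range_reflect (fun l => w (i + 1 + l))]
  refine congrArg _ (Finset.sum_congr rfl fun l hl => congrArg w ?_)
  have := Finset.mem_range.1 hl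
  omega

namespace IsMinimalWalk

theorem weight_le_of_reachesIn (h : G.IsMinimalWalk C n v w) (hi : i ≤ n)
    (hcol : G.IsColliderOn n v i) (hreach : G.ReachesIn C k (v i)) : w i ≤ k := by
  have := h.weight_le (h.trail hi) (h.trail_reverse hi)
    (canPass_of_reachesIn hcol.1 hcol.2 hreach) (by omega)
  rw [sum_range_split w hi] at this
  omega

/-- Otherwise both halves of the walk could be redirected to the next node `d` of the directed walk
from the collider `v i` to `C`, which would be lighter. -/
theorem exists_isDiscriminatingSegment_of_reachesIn (hG : G.IsAncestral)
    (h : G.IsMinimalWalk C n v w) (hi : i ≤ n) (hcol : G.IsColliderOn n v i)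
    (hdir : G.dir (v i) d) (hreach : G.ReachesIn C k d) (hw : w i = k + 1) :
    (∃ j < i, G.IsDiscriminatingSegment n v j i d) ∨
      ∃ j < n - i, G.IsDiscriminatingSegment n (fun l => v (n - l)) j (n - i) d := by
  have hsub : n - (n - i) = i := by omega
  have hbefore : G.ArrowBefore (fun l => v (n - l)) (n - i) := by
    rw [arrowBefore_reverse (by omega), hsub]
    exact hcol.2
  rcases h.exists_isDiscriminatingSegment_or_trail hG hi hcol.1 hdir with
    hseg | ⟨j, hj, hinto, htrail⟩
  · exact .inl hseg
  rcases h.toIsConnectingWalk.reverse.exists_isDiscriminatingSegment_or_trail hG (i := n - i)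
    (by omega) hbefore (by rwa [hsub]) with hseg | ⟨j', hj', hinto', htrail'⟩
  · exact .inr hseg
  exfalso
  simp only [Nat.sub_zero] at htrail'
  have hpass := canPass_of_reachesIn hinto hinto' hreach
  have hlength := h.length_le htrail htrail' hpass
  obtain rfl : i = j + 1 := by omega
  have hweight := h.weight_le htrail htrail' hpass (by omega)
  rw [sum_range_split w hi, show n - (j + 1) = j' + 1 by omega] at hweight
  omega

end IsMinimalWalk

namespace AgreeOnDiscriminated

theorem dir_of_isDiscriminatingSegment (h : G.AgreeOnDiscriminated H) (hG : G.IsAncestral)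
    (hH : H.IsAncestral) (hv : G.IsNodePath n v)
    (hord : ∀ k, k + 1 < n → G.Ordered (v k) (v (k + 1)) (v (k + 2))) (hj : j < i)
    (hcol : G.IsColliderOn n v i) (hdir : G.dir (v i) d)
    (hseg : G.IsDiscriminatingSegment n v j i d) : H.dir (v i) d := by
  obtain ⟨m, rfl⟩ := Nat.exists_eq_add_of_lt hj
  have hin : j + m + 1 < n := hcol.2.1
  have hcoldir : ∀ k ≤ m, G.IsColliderOn n v (j + k + 1) ∧ G.dir (v (j + k + 1)) d := by
    intro k hk
    rcases hk.lt_or_eq with hk | rfl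
    · have hmem : j + k + 1 ∈ Set.uIoo j (j + m + 1) :=
        Set.mem_uIoo_of_lt (by omega) (by omega)
      exact ⟨hseg.isColliderOn _ hmem, hseg.dir _ hmem⟩
    · exact ⟨hcol, hdir⟩
  have hne : v j ≠ d := by
    rintro rfl
    obtain ⟨hfirst, hback⟩ := hcoldir 0 (by omega)
    exact hG.not_into_of_dir hback hfirst.1.2
  have hcolG : ∀ k < m + 1, G.IsCollider (v (j + k)) (v (j + k + 1)) (v (j + k + 2)) :=
    fun k hk => (hv.isCollider_iff_isColliderOn (by omega)).2 (hcoldir k (by omega)).1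
  have hordG : ∀ k < m + 1, G.Ordered (v (j + k)) (v (j + k + 1)) (v (j + k + 2)) :=
    fun k hk => hord (j + k) (by omega)
  have hH' := fun k hk => h.ordered_and_isCollider_iff hG hH (hordG k hk)
  exact h.dir_of_dir hG hH (v := fun l => v (j + l)) (hv.segment (by omega)) hne hseg.not_adj
    hcolG (fun k hk => (hH' k hk).2.1 (hcolG k hk)) hordG (fun k hk => (hH' k hk).1)
    (fun k hk => (hcoldir k (by omega)).2) m (by omega)

theorem dir_of_isMinimalWalk (h : G.AgreeOnDiscriminated H) (hG : G.IsAncestral)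
    (hH : H.IsAncestral) (hmax : G.IsMaximal) (hwalk : G.IsMinimalWalk C n v w) (hi : i ≤ n)
    (hcol : G.IsColliderOn n v i) (hdir : G.dir (v i) d) (hreach : G.ReachesIn C k d)
    (hw : w i = k + 1) : H.dir (v i) d := by
  have hv := hwalk.isNodePath hG
  have hord : ∀ k, k + 1 < n → G.Ordered (v k) (v (k + 1)) (v (k + 2)) :=
    fun k hk => hwalk.ordered hG hmax k (by omega)
  rcases hwalk.exists_isDiscriminatingSegment_of_reachesIn hG hi hcol hdir hreach hw with
    ⟨j, hj, hseg⟩ | ⟨j, hj, hseg⟩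
  · exact h.dir_of_isDiscriminatingSegment hG hH hv hord hj hcol hdir hseg
  · have hsub : n - (n - i) = i := by omega
    have hordrev : ∀ k, k + 1 < n → G.Ordered (v (n - k)) (v (n - (k + 1))) (v (n - (k + 2))) := by
      intro k hk
      have := (hord (n - (k + 2)) (by omega)).symm
      rwa [show n - (k + 2) + 2 = n - k by omega,
        show n - (k + 2) + 1 = n - (k + 1) by omega] at this
    have := h.dir_of_isDiscriminatingSegment hG hH hv.reverse hordrev hj
      ((isColliderOn_reverse (by omega)).2 (by rwa [hsub])) (by rwa [hsub]) hseg
    rwa [hsub] at this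

/-- Consecutive triples of a shortest directed walk are unshielded, so that the direction of each
edge determines that of the next one. -/
theorem reachesIn (h : G.AgreeOnDiscriminated H) (hG : G.IsAncestral) (hH : H.IsAncestral)
    (hdir : G.dir u d) (hdirH : H.dir u d) (hreach : G.ReachesIn C k d)
    (hmin : ∀ l, G.ReachesIn C l u → k + 1 ≤ l) : H.ReachesIn C (k + 1) u := by
  refine ⟨d, hdirH, ?_⟩
  induction k generalizing u d with
  | zero => exact hreach
  | succ k ih =>
    obtain ⟨e, hde, hreach⟩ := hreach
    have hanc := (isAncestor_of_dir hdir).trans (isAncestor_of_dir hde)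
    have hne : u ≠ e := by
      rintro rfl
      exact hG.no_directed_cycle u hanc
    have hnadj : ¬ G.Adj u e := by
      intro hadj
      have := hmin (k + 1) ⟨e, hG.dir_of_isAncestor hanc hadj, hreach⟩
      omega
    have hiff := (h.ordered_and_isCollider_iff hG hH
      ⟨0, ⟨hne, adj_of_dir hdir, adj_of_dir hde⟩, hnadj⟩).2
    have hdeH : H.dir d e :=
      hH.dir_of_not_into (.inl hdirH) ((h.adj_iff _ _).1 (adj_of_dir hde)) fun hback =>
        hG.not_into_of_dir hde (hiff.2 ⟨hne, .inl hdirH, hback⟩).2.2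
    refine ⟨e, hdeH, ih hde hdeH hreach fun l hl => ?_⟩
    have := hmin (l + 1) ⟨d, hdir, hl⟩
    omega

theorem mConnected (h : G.AgreeOnDiscriminated H) (hG : G.IsAncestral) (hH : H.IsAncestral)
    (hmax : G.IsMaximal) (hxy : x ≠ y) (hconn : G.MConnected C x y) : H.MConnected C x y := by
  obtain ⟨n₀, v₀, w₀, rfl, rfl, hwalk₀⟩ := (hG.mConnected_iff_exists_isConnectingWalk hxy).1 hconn
  obtain ⟨n, v, w, hwalk, hstart, hend⟩ := hwalk₀.exists_isMinimalWalk hxy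
  have hv := hwalk.isNodePath hG
  refine hH.isSimple.mConnected_iff.2 ⟨n, v, hstart, hend,
    (hwalk.nodeConnecting hv).transfer (fun k hk => (h.adj_iff _ _).1 (hv.adj k hk))
      (fun k hk => (h.ordered_and_isCollider_iff hG hH (hwalk.ordered hG hmax k (by omega))).2)
      fun k hk hcol => ?_⟩
  have hcolOn := (hv.isCollider_iff_isColliderOn hk).1 hcol
  have hreach := (hwalk.canPass (k + 1) hk.le).reachesIn hcolOn.1 hcolOn.2
  have hmin := fun l => hwalk.weight_le_of_reachesIn hk.le hcolOn (k := l)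
  rcases hwk : w (k + 1) with _ | l
  · rw [hwk] at hreach
    exact .inl hreach
  · rw [hwk] at hreach hmin
    obtain ⟨d, hdir, hreach⟩ := hreach
    have hdirH := h.dir_of_isMinimalWalk hG hH hmax hwalk hk.le hcolOn hdir hreach hwk
    exact (h.reachesIn hG hH hdir hdirH hreach hmin).mem_union_ancestors

end AgreeOnDiscriminated

theorem markovEquiv_iff_collidersWithOrder (hG : G.IsAncestral) (hH : H.IsAncestral)
    (hmaxG : G.IsMaximal) (hmaxH : H.IsMaximal) :
    G.MarkovEquiv H ↔
      (∀ x y, G.Adj x y ↔ H.Adj x y) ∧ G.collidersWithOrder = H.collidersWithOrder := by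
  constructor
  · intro h
    have hagree := h.agreeOnDiscriminated hG hH hmaxG hmaxH
    exact ⟨hagree.adj_iff, hagree.collidersWithOrder_eq hG hH⟩
  · rintro ⟨hadj, h⟩
    have hagree := agreeOnDiscriminated_of_collidersWithOrder_eq hG.isSimple hH.isSimple hadj h
    exact markovEquiv_iff.2 fun C x y hxy =>
      ⟨hagree.mConnected hG hH hmaxG hxy, hagree.symm.mConnected hH hG hmaxH hxy⟩

end Transfer

section AgreeAtColliders

variable {V : Type*} {G H : LMG V} {C : Set V} {m n : ℕ} {x y z c : V} {v : ℕ → V}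

/-! ### Graphs that agree at colliders -/

/-- The graphs have the same adjacencies and colliders, and the same directed edges and ancestral
relations out of the central nodes of colliders. They may differ in the marks at noncolliders, which
affect neither the independence model nor the colliders with order. -/
structure AgreeAtColliders (G H : LMG V) : Prop where
  adj_iff : ∀ x y, G.Adj x y ↔ H.Adj x y
  isCollider_iff : ∀ x y z, G.IsCollider x y z ↔ H.IsCollider x y z
  dir_iff : ∀ ⦃x y z⦄, G.IsCollider x y z → ∀ u, G.dir y u ↔ H.dir y u
  isAncestor_iff : ∀ ⦃x y z⦄, G.IsCollider x y z → ∀ u, G.IsAncestor y u ↔ H.IsAncestor y u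

namespace AgreeAtColliders

theorem symm (h : G.AgreeAtColliders H) : H.AgreeAtColliders G where
  adj_iff x y := (h.adj_iff x y).symm
  isCollider_iff x y z := (h.isCollider_iff x y z).symm
  dir_iff _ _ _ hcol u := (h.dir_iff ((h.isCollider_iff _ _ _).2 hcol) u).symm
  isAncestor_iff _ _ _ hcol u := (h.isAncestor_iff ((h.isCollider_iff _ _ _).2 hcol) u).symm

theorem nodeConnecting (h : G.AgreeAtColliders H) (hv : G.NodeConnecting C n v) :
    H.NodeConnecting C n v :=
  hv.transfer (fun k hk => (h.adj_iff _ _).1 (hv.isNodePath.adj k hk))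
    (fun _ _ => h.isCollider_iff _ _ _) fun k hk hcol =>
      (hv.mem k hk hcol).imp_right fun ⟨z, hz, hanc⟩ => ⟨z, hz, (h.isAncestor_iff hcol z).1 hanc⟩

theorem markovEquiv (h : G.AgreeAtColliders H) (hG : G.IsSimple) (hH : H.IsSimple) :
    G.MarkovEquiv H := by
  refine markovEquiv_iff.2 fun C x y _ => ?_
  rw [hG.mConnected_iff, hH.mConnected_iff]
  exact ⟨fun ⟨n, v, hx, hy, hv⟩ => ⟨n, v, hx, hy, h.nodeConnecting hv⟩,
    fun ⟨n, v, hx, hy, hv⟩ => ⟨n, v, hx, hy, h.symm.nodeConnecting hv⟩⟩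

theorem nodeDiscriminating (h : G.AgreeAtColliders H) (hv : G.NodeDiscriminating m v c) :
    H.NodeDiscriminating m v c where
  isNodePath := ⟨fun k hk => (h.adj_iff _ _).1 (hv.isNodePath.adj k hk), hv.isNodePath.inj⟩
  start_ne := hv.start_ne
  adj_end := (h.adj_iff _ _).1 hv.adj_end
  not_adj := mt (h.adj_iff _ _).2 hv.not_adj
  isCollider k hk := (h.isCollider_iff _ _ _).1 (hv.isCollider k hk)
  dir k hk := (h.dir_iff (hv.isCollider k hk) _).1 (hv.dir k hk)

theorem ordered (h : G.AgreeAtColliders H) (hG : G.IsSimple) (hH : H.IsSimple)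
    (hord : G.Ordered x y z) : H.Ordered x y z :=
  hord.induction hG (P := H.Ordered)
    (fun _ _ _ hv hlt => (h.nodeDiscriminating hv).ordered hH fun k hk => (hlt k hk).2)
    fun _ _ _ => Ordered.symm

theorem collidersWithOrder_eq (h : G.AgreeAtColliders H) (hG : G.IsSimple) (hH : H.IsSimple) :
    G.collidersWithOrder = H.collidersWithOrder := by
  ext ⟨x, y, z⟩
  rw [mem_collidersWithOrder_iff, mem_collidersWithOrder_iff, h.isCollider_iff]
  exact and_congr_right fun _ => ⟨h.ordered hG hH, h.symm.ordered hH hG⟩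

end AgreeAtColliders

end AgreeAtColliders

section Extends

variable {V W : Type*} {K : LMG (V ⊕ W)} {G : LMG V} {m n : ℕ} {i j k : V} {x y : V ⊕ W}

/-! ### Adding nodes without arrowheads -/

/-- `G` is the subgraph of `K` induced by the left summand, and no edge of `K` has an arrowhead at a
node of the right summand. -/
structure Extends (K : LMG (V ⊕ W)) (G : LMG V) : Prop where
  hasEdge_iff : ∀ κ i j, K.HasEdge κ (.inl i) (.inl j) ↔ G.HasEdge κ i j
  not_into : ∀ x w, ¬ K.Into x (.inr w)

namespace Extends

theorem dir_iff (h : K.Extends G) : K.dir (.inl i) (.inl j) ↔ G.dir i j :=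
  h.hasEdge_iff .fwd i j

theorem bi_iff (h : K.Extends G) : K.bi (.inl i) (.inl j) ↔ G.bi i j :=
  h.hasEdge_iff .arc i j

theorem into_iff (h : K.Extends G) : K.Into (.inl i) (.inl j) ↔ G.Into i j :=
  or_congr h.dir_iff h.bi_iff

theorem adj_iff (h : K.Extends G) : K.Adj (.inl i) (.inl j) ↔ G.Adj i j :=
  exists_congr fun κ => h.hasEdge_iff κ i j

theorem exists_inl_of_into (h : K.Extends G) (hxy : K.Into x y) : ∃ i, y = .inl i := by
  rcases y with i | w
  · exact ⟨i, rfl⟩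
  · exact (h.not_into x w hxy).elim

theorem not_isAncestor_inr (h : K.Extends G) {w : W} : ¬ K.IsAncestor x (.inr w) := by
  intro hanc
  obtain ⟨y, -, hdir⟩ := Relation.TransGen.tail'_iff.1 hanc
  exact h.not_into y w (.inl hdir)

theorem isAncestor_iff (h : K.Extends G) :
    K.IsAncestor (.inl i) (.inl j) ↔ G.IsAncestor i j := by
  refine ⟨fun hanc => ?_, Relation.TransGen.lift Sum.inl (fun _ _ => h.dir_iff.2) _ _⟩
  generalize hy : Sum.inl j = y at hanc
  induction hanc generalizing j with
  | single hdir =>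
    subst hy
    exact isAncestor_of_dir (h.dir_iff.1 hdir)
  | @tail z _ hz hdir ih =>
    subst hy
    rcases z with k | w
    · exact (ih rfl).trans (isAncestor_of_dir (h.dir_iff.1 hdir))
    · exact (h.not_isAncestor_inr hz).elim

theorem isCollider_iff (h : K.Extends G) :
    K.IsCollider (.inl i) (.inl j) (.inl k) ↔ G.IsCollider i j k := by
  rw [LMG.isCollider_iff, LMG.isCollider_iff, h.into_iff, h.into_iff, ne_eq, Sum.inl.injEq]

theorem isNodePath_iff (h : K.Extends G) {v : ℕ → V} :
    K.IsNodePath n (fun k => .inl (v k)) ↔ G.IsNodePath n v :=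
  ⟨fun hv => ⟨fun k hk => h.adj_iff.1 (hv.adj k hk),
      fun k hk l hl heq => hv.inj k hk l hl (congrArg _ heq)⟩,
    fun hv => ⟨fun k hk => h.adj_iff.2 (hv.adj k hk),
      fun k hk l hl heq => hv.inj k hk l hl (Sum.inl.inj heq)⟩⟩

theorem nodeDiscriminating (h : K.Extends G) {v : ℕ → V} {c : V}
    (hv : G.NodeDiscriminating m v c) :
    K.NodeDiscriminating m (fun k => .inl (v k)) (.inl c) where
  isNodePath := h.isNodePath_iff.2 hv.isNodePath
  start_ne := Sum.inl_injective.ne hv.start_ne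
  adj_end := h.adj_iff.2 hv.adj_end
  not_adj := mt h.adj_iff.1 hv.not_adj
  isCollider k hk := h.isCollider_iff.2 (hv.isCollider k hk)
  dir k hk := h.dir_iff.2 (hv.dir k hk)

theorem ordered (h : K.Extends G) (hK : K.IsSimple) (hG : G.IsSimple) (hord : G.Ordered i j k) :
    K.Ordered (.inl i) (.inl j) (.inl k) :=
  hord.induction hG (P := fun i j k => K.Ordered (.inl i) (.inl j) (.inl k))
    (fun _ _ _ hv hlt => (h.nodeDiscriminating hv).ordered hK fun k hk => (hlt k hk).2)
    fun _ _ _ => Ordered.symm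

theorem nodeInducing_iff (h : K.Extends G) {v : ℕ → V} :
    K.NodeInducing n (fun k => .inl (v k)) ↔ G.NodeInducing n v :=
  ⟨fun hv => ⟨h.isNodePath_iff.1 hv.isNodePath,
      fun k hk => h.isCollider_iff.1 (hv.isCollider k hk),
      fun k hk => (hv.isAncestor k hk).imp h.isAncestor_iff.1 h.isAncestor_iff.1⟩,
    fun hv => ⟨h.isNodePath_iff.2 hv.isNodePath,
      fun k hk => h.isCollider_iff.2 (hv.isCollider k hk),
      fun k hk => (hv.isAncestor k hk).imp h.isAncestor_iff.2 h.isAncestor_iff.2⟩⟩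

theorem inducingConnected (h : K.Extends G) (hK : K.IsSimple) (hG : G.IsSimple)
    (hij : G.InducingConnected i j) : K.InducingConnected (.inl i) (.inl j) := by
  obtain ⟨n, v, hv, rfl, rfl⟩ := hG.inducingConnected_iff.1 hij
  exact hK.inducingConnected_iff.2 ⟨n, _, h.nodeInducing_iff.2 hv, rfl, rfl⟩

/-- All edges of an inducing path between nonadjacent nodes are bidirected, so that the path stays
in the left summand. -/
theorem exists_inl_of_inducingConnected (h : K.Extends G) (hK : K.IsAncestral) (hG : G.IsSimple)
    (hne : x ≠ y) (hadj : ¬ K.Adj x y) (hxy : K.InducingConnected x y) :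
    ∃ i j, x = .inl i ∧ y = .inl j ∧ G.InducingConnected i j := by
  obtain ⟨n, v, hv, rfl, rfl⟩ := hK.isSimple.inducingConnected_iff.1 hxy
  have hn := hv.two_le hne hadj
  have hinl : ∀ k, ∃ i, k ≤ n → v k = .inl i := by
    intro k
    rcases Nat.lt_or_ge k n with hk | hk
    · exact (h.exists_inl_of_into (.inr (K.bi_symm (hv.bi hK hn hk)))).imp fun i hi _ => hi
    · obtain ⟨i, hi⟩ := h.exists_inl_of_into (.inr (hv.bi_last hK hn))
      exact ⟨i, fun hkn => by rwa [hkn.antisymm hk]⟩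
  choose u hu using hinl
  have huv : K.NodeInducing n (fun k => .inl (u k)) := by
    refine ⟨hv.isNodePath.congr fun k hk => (hu k hk).symm, fun k hk => ?_, fun k hk => ?_⟩
    · rw [← hu k (by omega), ← hu (k + 1) hk.le, ← hu (k + 2) hk]
      exact hv.isCollider k hk
    · rw [← hu 0 (by omega), ← hu (k + 1) hk.le, ← hu n le_rfl]
      exact hv.isAncestor k hk
  exact ⟨u 0, u n, hu 0 (by omega), hu n le_rfl,
    hG.inducingConnected_iff.2 ⟨n, u, h.nodeInducing_iff.1 huv, rfl, rfl⟩⟩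

theorem isMaximal (h : K.Extends G) (hK : K.IsAncestral) (hG : G.IsSimple) (hmax : G.IsMaximal) :
    K.IsMaximal := by
  intro x y hne hxy
  by_contra hadj
  obtain ⟨i, j, rfl, rfl, hij⟩ := h.exists_inl_of_inducingConnected hK hG hne hadj hxy
  exact hadj (h.adj_iff.2 (hmax i j (fun heq => hne (congrArg _ heq)) hij))

theorem maximalExtension (h : K.Extends G) (hK : K.IsAncestral) (hG : G.IsSimple) :
    K.maximalExtension.Extends G.maximalExtension where
  hasEdge_iff κ i j := by
    cases κ with
    | arc =>
      refine or_congr h.bi_iff ⟨fun ⟨hne, hadj, hij⟩ => ?_, fun ⟨hne, hadj, hij⟩ => ?_⟩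
      · obtain ⟨_, _, hi, hj, hij'⟩ := h.exists_inl_of_inducingConnected hK hG hne hadj hij
        cases hi
        cases hj
        exact ⟨fun heq => hne (congrArg _ heq), mt h.adj_iff.2 hadj, hij'⟩
      · exact ⟨Sum.inl_injective.ne hne, mt h.adj_iff.1 hadj,
          h.inducingConnected hK.isSimple hG hij⟩
    | line => exact h.hasEdge_iff .line i j
    | fwd => exact h.hasEdge_iff .fwd i j
    | bwd => exact h.hasEdge_iff .bwd i j
  not_into x w := by
    rintro (hdir | hbi | ⟨hne, hadj, hxw⟩)
    · exact h.not_into x w (.inl hdir)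
    · exact h.not_into x w (.inr hbi)
    · obtain ⟨_, _, -, hw, -⟩ := h.exists_inl_of_inducingConnected hK hG hne hadj hxw
      cases hw

end Extends

end Extends

section Interventional

variable {V ι : Type*} {G H : LMG V} {T : ι → Set V} {i : V} {w : InterventionNode T}
  {x y z : V ⊕ InterventionNode T}

/-! ### The ancestral version of the interventional graph -/

/-- The undirected edges of `ancestralInterventional`. -/
def ancestralInterventionalUnd (G : LMG V) (T : ι → Set V) :
    V ⊕ InterventionNode T → V ⊕ InterventionNode T → Prop
  | .inl i, .inl j => G.und i j
  | .inl i, .inr w => i ∈ T w.1 ∧ G.SelectionAdjacent i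
  | .inr w, .inl j => j ∈ T w.1 ∧ G.SelectionAdjacent j
  | .inr _, .inr _ => False

/-- The directed edges of `ancestralInterventional`. -/
def ancestralInterventionalDir (G : LMG V) (T : ι → Set V) :
    V ⊕ InterventionNode T → V ⊕ InterventionNode T → Prop
  | .inl i, .inl j => G.dir i j
  | .inr w, .inl j => j ∈ T w.1 ∧ ¬ G.SelectionAdjacent j
  | _, .inr _ => False

/-- The interventional graph, with the edges from interventional nodes to selection adjacent nodes
made undirected. Unlike the interventional graph, it is ancestral whenever `G` is. -/
def ancestralInterventional (G : LMG V) (T : ι → Set V) : LMG (V ⊕ InterventionNode T) where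
  und := G.ancestralInterventionalUnd T
  bi := liftRel T G.bi
  dir := G.ancestralInterventionalDir T
  und_symm := by
    rintro (i | i) (j | j) h
    · exact G.und_symm h
    all_goals exact h
  bi_symm := by
    rintro (i | i) (j | j) h
    · exact G.bi_symm h
    all_goals exact h
  und_irrefl := by
    rintro (i | i) h
    · exact G.und_irrefl i h
    · exact h
  bi_irrefl := by
    rintro (i | i) h
    · exact G.bi_irrefl i h
    · exact h
  dir_irrefl := by
    rintro (i | i) h
    · exact G.dir_irrefl i h
    · exact h

theorem extends_interventional (G : LMG V) (T : ι → Set V) : (G.interventional T).Extends G where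
  hasEdge_iff κ i j := by cases κ <;> rfl
  not_into := by rintro (x | x) w (h | h) <;> exact h

theorem extends_ancestralInterventional (G : LMG V) (T : ι → Set V) :
    (G.ancestralInterventional T).Extends G where
  hasEdge_iff κ i j := by cases κ <;> rfl
  not_into := by rintro (x | x) w (h | h) <;> exact h

theorem interventional_into_inr_inl_iff :
    (G.interventional T).Into (.inr w) (.inl i) ↔ i ∈ T w.1 :=
  or_iff_left id

theorem ancestralInterventional_into_inr_inl_iff :
    (G.ancestralInterventional T).Into (.inr w) (.inl i) ↔
      i ∈ T w.1 ∧ ¬ G.SelectionAdjacent i :=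
  or_iff_left id

theorem interventional_adj_inr_inl_iff :
    (G.interventional T).Adj (.inr w) (.inl i) ↔ i ∈ T w.1 := by
  rw [adj_iff]
  change False ∨ False ∨ i ∈ T w.1 ∨ False ↔ i ∈ T w.1
  tauto

theorem ancestralInterventional_adj_inr_inl_iff :
    (G.ancestralInterventional T).Adj (.inr w) (.inl i) ↔ i ∈ T w.1 := by
  rw [adj_iff]
  change (i ∈ T w.1 ∧ G.SelectionAdjacent i) ∨ False ∨ (i ∈ T w.1 ∧ ¬ G.SelectionAdjacent i) ∨
    False ↔ i ∈ T w.1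
  tauto

theorem interventional_adj_iff_ancestralInterventional_adj :
    (G.interventional T).Adj x y ↔ (G.ancestralInterventional T).Adj x y := by
  rcases x with x | x <;> rcases y with y | y
  · rw [(extends_interventional G T).adj_iff, (extends_ancestralInterventional G T).adj_iff]
  · rw [adj_comm, interventional_adj_inr_inl_iff, adj_comm,
      ancestralInterventional_adj_inr_inl_iff]
  · rw [interventional_adj_inr_inl_iff, ancestralInterventional_adj_inr_inl_iff]
  · rw [adj_iff, adj_iff]
    rfl

theorem forall_interventional_adj_iff :
    (∀ x y, (G.interventional T).Adj x y ↔ (H.interventional T).Adj x y) ↔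
      ∀ x y, G.Adj x y ↔ H.Adj x y := by
  have hG := extends_interventional G T
  have hH := extends_interventional H T
  constructor
  · intro h x y
    rw [← hG.adj_iff, ← hH.adj_iff, h]
  · rintro h (x | x) (y | y)
    · rw [hG.adj_iff, hH.adj_iff, h]
    · rw [adj_comm, interventional_adj_inr_inl_iff, adj_comm, interventional_adj_inr_inl_iff]
    · rw [interventional_adj_inr_inl_iff, interventional_adj_inr_inl_iff]
    · rw [adj_iff, adj_iff]
      rfl

theorem IsSimple.interventional (hG : G.IsSimple) (T : ι → Set V) :
    (G.interventional T).IsSimple := by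
  have hext := extends_interventional G T
  rintro (u | u) (v | v) κ κ' h h'
  · exact hG ((hext.hasEdge_iff _ _ _).1 h) ((hext.hasEdge_iff _ _ _).1 h')
  all_goals cases κ <;> cases κ' <;> first | rfl | exact h.elim | exact h'.elim

theorem not_ancestralInterventional_into_of_und (hG : G.IsAncestral)
    (hxy : (G.ancestralInterventional T).und x y) : ¬ (G.ancestralInterventional T).Into z x := by
  rcases x with i | w
  · have hi : G.SelectionAdjacent i := by
      rcases y with j | w
      exacts [⟨j, hxy⟩, hxy.2]
    rcases z with k | w
    · obtain ⟨j, hij⟩ := hi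
      exact fun hinto => hG.not_und_of_into
        ((extends_ancestralInterventional G T).into_iff.1 hinto) hij
    · exact fun hinto => (ancestralInterventional_into_inr_inl_iff.1 hinto).2 hi
  · exact (extends_ancestralInterventional G T).not_into z w

theorem IsAncestral.ancestralInterventional (hG : G.IsAncestral) (T : ι → Set V) :
    (G.ancestralInterventional T).IsAncestral where
  no_directed_cycle := by
    rintro (i | w) h
    · exact hG.no_directed_cycle i ((extends_ancestralInterventional G T).isAncestor_iff.1 h)
    · exact (extends_ancestralInterventional G T).not_isAncestor_inr h
  bi_no_directed_path := by
    rintro (i | i) (j | j) h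
    · rw [(extends_ancestralInterventional G T).isAncestor_iff,
        (extends_ancestralInterventional G T).isAncestor_iff]
      exact hG.bi_no_directed_path i j h
    all_goals exact h.elim
  und_no_arrowhead x y h z :=
    have hx := not_ancestralInterventional_into_of_und hG h (z := z)
    have hy := not_ancestralInterventional_into_of_und hG
      ((G.ancestralInterventional T).und_symm h) (z := z)
    ⟨fun h => hx (.inl h), fun h => hx (.inr h), fun h => hy (.inl h), fun h => hy (.inr h)⟩

/-- Two arrowheads at a selection adjacent node come from two interventional nodes. -/
theorem not_selectionAdjacent_of_isCollider (hG : G.IsAncestral)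
    (hT : G.SelectionAdjacent i → ¬ DoublyIntervenes T i)
    (hcol : (G.interventional T).IsCollider x (.inl i) z) : ¬ G.SelectionAdjacent i := by
  intro hsel
  have hexists : ∀ u, (G.interventional T).Into u (.inl i) →
      ∃ w : InterventionNode T, u = .inr w ∧ i ∈ T w.1 := by
    rintro (k | w) hinto
    · obtain ⟨j, hij⟩ := hsel
      exact (hG.not_und_of_into ((extends_interventional G T).into_iff.1 hinto) hij).elim
    · exact ⟨w, rfl, interventional_into_inr_inl_iff.1 hinto⟩
  obtain ⟨hne, hx, hz⟩ := isCollider_iff.1 hcol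
  obtain ⟨w, rfl, hw⟩ := hexists x hx
  obtain ⟨w', rfl, hw'⟩ := hexists z hz
  exact hT hsel ⟨w.1, w'.1, fun heq => hne (congrArg _ (Subtype.ext heq)), hw, hw'⟩

theorem interventional_isCollider_iff (hG : G.IsAncestral)
    (hT : ∀ i, G.SelectionAdjacent i → ¬ DoublyIntervenes T i) :
    (G.interventional T).IsCollider x y z ↔ (G.ancestralInterventional T).IsCollider x y z := by
  rcases y with i | w
  · have hinto : ∀ u, (G.ancestralInterventional T).Into u (.inl i) ↔
        (G.interventional T).Into u (.inl i) ∧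
          ((∃ w, u = .inr w) → ¬ G.SelectionAdjacent i) := by
      rintro (k | w)
      · rw [(extends_interventional G T).into_iff, (extends_ancestralInterventional G T).into_iff]
        simp
      · rw [interventional_into_inr_inl_iff, ancestralInterventional_into_inr_inl_iff]
        simp
    rw [isCollider_iff, isCollider_iff, hinto, hinto]
    refine ⟨fun hcol => ?_, fun ⟨hne, hx, hz⟩ => ⟨hne, hx.1, hz.1⟩⟩
    have hsel := not_selectionAdjacent_of_isCollider hG (hT i) hcol
    exact ⟨hcol.1, ⟨hcol.2.1, fun _ => hsel⟩, ⟨hcol.2.2, fun _ => hsel⟩⟩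
  · exact ⟨fun hcol => ((extends_interventional G T).not_into x w hcol.2.1).elim,
      fun hcol => ((extends_ancestralInterventional G T).not_into x w hcol.2.1).elim⟩

theorem agreeAtColliders_interventional (hG : G.IsAncestral)
    (hT : ∀ i, G.SelectionAdjacent i → ¬ DoublyIntervenes T i) :
    (G.interventional T).AgreeAtColliders (G.ancestralInterventional T) where
  adj_iff _ _ := interventional_adj_iff_ancestralInterventional_adj
  isCollider_iff _ _ _ := interventional_isCollider_iff hG hT
  dir_iff _ _ _ hcol u := by
    obtain ⟨i, rfl⟩ := (extends_interventional G T).exists_inl_of_into hcol.2.1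
    rcases u with u | u <;> rfl
  isAncestor_iff _ _ _ hcol u := by
    have hext := extends_interventional G T
    have hext' := extends_ancestralInterventional G T
    obtain ⟨i, rfl⟩ := hext.exists_inl_of_into hcol.2.1
    rcases u with u | u
    · rw [hext.isAncestor_iff, hext'.isAncestor_iff]
    · exact iff_of_false hext.not_isAncestor_inr hext'.not_isAncestor_inr

theorem eq_of_hasEdge_iff (h : ∀ κ u v, G.HasEdge κ u v ↔ H.HasEdge κ u v) : G = H := by
  obtain ⟨und, bi, dir⟩ := G
  obtain ⟨und', bi', dir'⟩ := H
  obtain rfl : und = und' := funext₂ fun u v => propext (h .line u v)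
  obtain rfl : bi = bi' := funext₂ fun u v => propext (h .arc u v)
  obtain rfl : dir = dir' := funext₂ fun u v => propext (h .fwd u v)
  rfl

theorem ancestralInterventional_maximalExtension (hG : G.IsAncestral) (T : ι → Set V) :
    G.maximalExtension.ancestralInterventional T =
      (G.ancestralInterventional T).maximalExtension := by
  have hleft := extends_ancestralInterventional G.maximalExtension T
  have hright := (extends_ancestralInterventional G T).maximalExtension
    (hG.ancestralInterventional T) hG.isSimple
  refine eq_of_hasEdge_iff fun κ x y => ?_
  cases κ with
  | arc =>
    rcases x with x | x <;> rcases y with y | y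
    · exact (hleft.hasEdge_iff .arc x y).trans (hright.hasEdge_iff .arc x y).symm
    · exact iff_of_false (fun h => hleft.not_into _ y (.inr h))
        (fun h => hright.not_into _ y (.inr h))
    all_goals
      exact iff_of_false (fun h => hleft.not_into _ x (.inr (LMG.bi_symm _ h)))
        (fun h => hright.not_into _ x (.inr (LMG.bi_symm _ h)))
  | line => rcases x with x | x <;> rcases y with y | y <;> rfl
  | fwd => rcases x with x | x <;> rcases y with y | y <;> rfl
  | bwd => rcases x with x | x <;> rcases y with y | y <;> rfl

/-! ### Interventional Markov equivalence -/

theorem markovEquiv_ancestralInterventional (hG : G.IsAncestral)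
    (hT : ∀ i, G.SelectionAdjacent i → ¬ DoublyIntervenes T i) :
    (G.interventional T).MarkovEquiv (G.ancestralInterventional T) :=
  (agreeAtColliders_interventional hG hT).markovEquiv (hG.isSimple.interventional T)
    (hG.ancestralInterventional T).isSimple

theorem iMarkovEquiv_maximalExtension (hG : G.IsAncestral)
    (hT : ∀ i, G.SelectionAdjacent i → ¬ DoublyIntervenes T i) :
    IMarkovEquiv T G G.maximalExtension :=
  calc (G.interventional T).indepModel
    _ = (G.ancestralInterventional T).indepModel := markovEquiv_ancestralInterventional hG hT
    _ = (G.ancestralInterventional T).maximalExtension.indepModel :=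
      (hG.ancestralInterventional T).markovEquiv_maximalExtension
    _ = (G.maximalExtension.ancestralInterventional T).indepModel := by
      rw [ancestralInterventional_maximalExtension hG]
    _ = (G.maximalExtension.interventional T).indepModel :=
      (markovEquiv_ancestralInterventional hG.maximalExtension hT).symm

theorem iMarkovEquiv_maximalExtension_iff (hG : G.IsAncestral) (hH : H.IsAncestral)
    (hGT : ∀ i, G.SelectionAdjacent i → ¬ DoublyIntervenes T i)
    (hHT : ∀ i, H.SelectionAdjacent i → ¬ DoublyIntervenes T i) :
    IMarkovEquiv T G.maximalExtension H.maximalExtension ↔ IMarkovEquiv T G H := by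
  rw [IMarkovEquiv, IMarkovEquiv, iMarkovEquiv_maximalExtension hG hGT,
    iMarkovEquiv_maximalExtension hH hHT]

theorem iMarkovEquiv_iff_collidersWithOrder (hG : G.IsAncestral) (hH : H.IsAncestral)
    (hmaxG : G.IsMaximal) (hmaxH : H.IsMaximal)
    (hGT : ∀ i, G.SelectionAdjacent i → ¬ DoublyIntervenes T i)
    (hHT : ∀ i, H.SelectionAdjacent i → ¬ DoublyIntervenes T i) :
    IMarkovEquiv T G H ↔ (∀ x y, G.Adj x y ↔ H.Adj x y) ∧
      (G.interventional T).collidersWithOrder = (H.interventional T).collidersWithOrder := by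
  have hGA := hG.ancestralInterventional T
  have hHA := hH.ancestralInterventional T
  have hmarkov := markovEquiv_iff_collidersWithOrder hGA hHA
    ((extends_ancestralInterventional G T).isMaximal hGA hG.isSimple hmaxG)
    ((extends_ancestralInterventional H T).isMaximal hHA hH.isSimple hmaxH)
  rw [IMarkovEquiv, markovEquiv_ancestralInterventional hG hGT,
    markovEquiv_ancestralInterventional hH hHT, ← MarkovEquiv, hmarkov,
    (agreeAtColliders_interventional hG hGT).collidersWithOrder_eq (hG.isSimple.interventional T)
      hGA.isSimple,
    (agreeAtColliders_interventional hH hHT).collidersWithOrder_eq (hH.isSimple.interventional T)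
      hHA.isSimple, ← forall_interventional_adj_iff (T := T)]
  simp only [interventional_adj_iff_ancestralInterventional_adj]

theorem collidersWithOrder_interventional (hG : G.IsSimple) (T : ι → Set V) :
    (G.interventional T).collidersWithOrder = G.ICollidersWithOrder T ∪
      (fun x : V × V × V => (Sum.inl x.1, Sum.inl x.2.1, Sum.inl x.2.2)) ''
        G.collidersWithOrder := by
  rw [ICollidersWithOrder, Set.sdiff_union_of_subset]
  rintro _ ⟨⟨i, j, k⟩, h, rfl⟩
  obtain ⟨hcol, hord⟩ := mem_collidersWithOrder_iff.1 h
  have hext := extends_interventional G T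
  exact mem_collidersWithOrder_iff.2
    ⟨hext.isCollider_iff.2 hcol, hext.ordered (hG.interventional T) hG hord⟩

theorem AgreeOnDiscriminated.of_interventional (hG : G.IsSimple) (hH : H.IsSimple)
    (h : (G.interventional T).AgreeOnDiscriminated (H.interventional T)) :
    G.AgreeOnDiscriminated H where
  adj_iff := forall_interventional_adj_iff.1 h.adj_iff
  isCollider_iff m v c hvG hvH hordG hordH := by
    have hextG := extends_interventional G T
    have hextH := extends_interventional H T
    rw [← hextG.isCollider_iff, ← hextH.isCollider_iff]
    exact h.isCollider_iff (hextG.nodeDiscriminating hvG) (hextH.nodeDiscriminating hvH)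
      (fun k hk => hextG.ordered (hG.interventional T) hG (hordG k hk))
      fun k hk => hextH.ordered (hH.interventional T) hH (hordH k hk)

theorem iMarkovEquiv_iff_iCollidersWithOrder (hG : G.IsAncestral) (hH : H.IsAncestral)
    (hmaxG : G.IsMaximal) (hmaxH : H.IsMaximal)
    (hGT : ∀ i, G.SelectionAdjacent i → ¬ DoublyIntervenes T i)
    (hHT : ∀ i, H.SelectionAdjacent i → ¬ DoublyIntervenes T i) :
    IMarkovEquiv T G H ↔
      G.MarkovEquiv H ∧ G.ICollidersWithOrder T = H.ICollidersWithOrder T := by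
  rw [iMarkovEquiv_iff_collidersWithOrder hG hH hmaxG hmaxH hGT hHT,
    markovEquiv_iff_collidersWithOrder hG hH hmaxG hmaxH]
  constructor
  · rintro ⟨hadj, hcolT⟩
    have hagree : G.AgreeOnDiscriminated H :=
      .of_interventional hG.isSimple hH.isSimple <|
        agreeOnDiscriminated_of_collidersWithOrder_eq (hG.isSimple.interventional T)
          (hH.isSimple.interventional T) (forall_interventional_adj_iff.2 hadj) hcolT
    have hcol := hagree.collidersWithOrder_eq hG hH
    exact ⟨⟨hadj, hcol⟩, by rw [ICollidersWithOrder, ICollidersWithOrder, hcolT, hcol]⟩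
  · rintro ⟨⟨hadj, hcol⟩, hcolT⟩
    refine ⟨hadj, ?_⟩
    rw [collidersWithOrder_interventional hG.isSimple,
      collidersWithOrder_interventional hH.isSimple, hcolT, hcol]

end Interventional

end LMG

theorem mainTheorem1_general {V ι : Type*} (G H : LMG V)
    (hG : G.IsAncestral) (hH : H.IsAncestral) (T : ι → Set V)
    (hGT : ∀ i, G.SelectionAdjacent i → ¬ LMG.DoublyIntervenes T i)
    (hHT : ∀ i, H.SelectionAdjacent i → ¬ LMG.DoublyIntervenes T i) :
    List.TFAE [
      LMG.IMarkovEquiv T G H,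
      LMG.IMarkovEquiv T G.maximalExtension H.maximalExtension,
      LMG.MarkovEquiv G.maximalExtension H.maximalExtension ∧
        G.maximalExtension.ICollidersWithOrder T = H.maximalExtension.ICollidersWithOrder T] := by
  tfae_have 2 ↔ 1 := LMG.iMarkovEquiv_maximalExtension_iff hG hH hGT hHT
  tfae_have 2 ↔ 3 := LMG.iMarkovEquiv_iff_iCollidersWithOrder hG.maximalExtension
    hH.maximalExtension hG.maximalExtension_isMaximal hH.maximalExtension_isMaximal hGT hHT
  tfae_finish

theorem mainTheorem1 {V ι : Type*} [Finite V] [Finite ι] (G H : LMG V)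
    (hG : G.IsAncestral) (hH : H.IsAncestral) (T : ι → Set V)
    (hGT : ∀ i, G.SelectionAdjacent i → ¬ LMG.DoublyIntervenes T i)
    (hHT : ∀ i, H.SelectionAdjacent i → ¬ LMG.DoublyIntervenes T i) :
    List.TFAE [
      LMG.IMarkovEquiv T G H,
      LMG.IMarkovEquiv T G.maximalExtension H.maximalExtension,
      LMG.MarkovEquiv G.maximalExtension H.maximalExtension ∧
        G.maximalExtension.ICollidersWithOrder T = H.maximalExtension.ICollidersWithOrder T] :=
  mainTheorem1_general G H hG hH T hGT hHT
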